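/- A multi-agent multi-action contract setting consists of $n$ agents, a set $A$ of $m$ actions that is partitioned into the action sets $A_1,\dots,A_n$ of the agents, costs $c_j \ge 0$ for $j \in A$, a reward $r > 0$, and a success probability $f : 2^A \to [0,1]$ with $f(\emptyset) = 0$ and $f(S) \le f(T)$ for $S \subseteq T$. It is submodular if $f(S \cup \{j\}) - f(S) \ge f(T \cup \{j\}) - f(T)$ for all $S \subseteq T \subseteq A$ and $j \in A$. A contract is a vector $\alpha \in [0,1]^n$. If the actions in $S \subseteq A$ are taken, the principal's utility is $u_p(S,\alpha) = (1 - \sum_i \alpha_i) f(S)\, r$ and the utility of agent $i$ is $u_i(S,\alpha) = \alpha_i f(S)\, r - \sum_{j \in S \cap A_i} c_j$. The set $S$ is a (pure Nash) equilibrium of $\alpha$ if $u_i(S,\alpha) \ge u_i(T \cup (S \setminus A_i),\alpha)$ for every agent $i$ and every $T \subseteq A_i$. A value oracle for $f$ returns $f(S)$ for a given $S \subseteq A$; a demand oracle for $f$ returns, for a given price vector $p \in \mathbb{R}^A$, some set $S$ that maximizes $f(S) - \sum_{j \in S} p_j$. **Theorem.** There are an absolute constant $\kappa > 0$, a polynomial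 $q$ and an algorithm (a single program for a real random access machine, whose unit-cost operations on real numbers are the four arithmetic operations, square roots and exact comparisons) such that the following holds. For every multi-agent multi-action contract setting with submodular $f$, given $n$, $m$, the partition of $A$, the costs, the reward, and access to $f$ through a value oracle and any demand oracle for $f$, the algorithm halts after at most $q(n+m)$ steps, at most $q(n+m)$ value queries and at most $q(n+m)$ demand queries, and it outputs a contract $\alpha$ such that every equilibrium $S$ of $\alpha$ satisfies $$u_p(S,\alpha) \;\ge\; \kappa \cdot \sup_{\alpha' \in [0,1]^n}\ \sup_{S' \text{ equilibrium of } \alpha'} u_p(S',\alpha').$$ -/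

import Mathlib

/-! ### Multi-agent multi-action contract settings -/

/-- A contract setting with `n` agents and `m` actions.  The action `j` belongs to the agent
`agent j`, so that the action sets `A_i` are disjoint and cover all actions (some may be empty).
The principal receives `reward` if the project succeeds and nothing otherwise; if the actions in
`S` are taken, the project succeeds with probability `f S`. -/
structure ContractSetting (n m : ℕ) where
  agent : Fin m → Fin n
  cost : Fin m → ℝ
  cost_nonneg : ∀ j, 0 ≤ cost j
  reward : ℝ
  reward_pos : 0 < reward
  f : Finset (Fin m) → ℝ
  f_empty : f ∅ = 0
  f_mono : ∀ S T : Finset (Fin m), S ⊆ T → f S ≤ f T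
  f_le_one : ∀ S, f S ≤ 1

namespace ContractSetting

variable {n m : ℕ}

/-- The set `A_i` of the actions of agent `i`. -/
def actions (I : ContractSetting n m) (i : Fin n) : Finset (Fin m) :=
  Finset.univ.filter fun j => I.agent j = i

/-- Marginal contributions are non-increasing. -/
def IsSubmodular (I : ContractSetting n m) : Prop :=
  ∀ S T : Finset (Fin m), S ⊆ T → ∀ j : Fin m,
    I.f (T ∪ {j}) - I.f T ≤ I.f (S ∪ {j}) - I.f S

/-- The principal's expected utility under the contract `α` if the actions `S` are taken. -/
noncomputable def principalUtility (I : ContractSetting n m) (α : Fin n → ℝ)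
    (S : Finset (Fin m)) : ℝ :=
  (1 - ∑ i, α i) * I.f S * I.reward

/-- The expected utility of agent `i` under the contract `α` if the actions `S` are taken. -/
noncomputable def agentUtility (I : ContractSetting n m) (α : Fin n → ℝ)
    (S : Finset (Fin m)) (i : Fin n) : ℝ :=
  α i * I.f S * I.reward - ∑ j ∈ S ∩ I.actions i, I.cost j

/-- `S` is a pure Nash equilibrium of `α`: no agent `i` gains by replacing `S ∩ A_i` by another
subset of `A_i`. -/
def IsNash (I : ContractSetting n m) (α : Fin n → ℝ) (S : Finset (Fin m)) : Prop :=
  ∀ i : Fin n, ∀ T : Finset (Fin m), T ⊆ I.actions i →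
    I.agentUtility α (T ∪ (S \ I.actions i)) i ≤ I.agentUtility α S i

/-- A (linear) contract pays every agent a fraction of the reward upon success. -/
def IsContract (α : Fin n → ℝ) : Prop :=
  ∀ i, 0 ≤ α i ∧ α i ≤ 1

/-- The values that the principal's utility takes over all contracts and all their equilibria. -/
def achievable (I : ContractSetting n m) : Set ℝ :=
  {u | ∃ α : Fin n → ℝ, IsContract α ∧ ∃ S, I.IsNash α S ∧ u = I.principalUtility α S}

/-- The optimal principal utility: the supremum over all contracts and all their equilibria. -/
noncomputable def optUtility (I : ContractSetting n m) : ℝ :=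
  sSup I.achievable

theorem f_nonneg (I : ContractSetting n m) (S : Finset (Fin m)) : 0 ≤ I.f S := by
  have h := I.f_mono ∅ S (Finset.empty_subset S)
  rwa [I.f_empty] at h

/-- The supremum is over a bounded set. -/
theorem bddAbove_achievable (I : ContractSetting n m) : BddAbove I.achievable := by
  refine ⟨I.reward, ?_⟩
  rintro u ⟨α, hα, S, -, rfl⟩
  have h0 : 0 ≤ ∑ i, α i := Finset.sum_nonneg fun i _ => (hα i).1
  have h1 := I.f_nonneg S
  have h2 := I.f_le_one S
  have h3 := I.reward_pos
  have h4 : (1 - ∑ i, α i) * I.f S ≤ 1 := by nlinarith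
  unfold principalUtility
  nlinarith

/-- The supremum is over a non-empty set. -/
theorem achievable_nonempty (I : ContractSetting n m) : I.achievable.Nonempty := by
  refine ⟨_, fun _ => 0, fun _ => ⟨le_rfl, zero_le_one⟩, ∅, ?_, rfl⟩
  intro i T _
  have h : 0 ≤ ∑ j ∈ (T ∪ (∅ \ I.actions i)) ∩ I.actions i, I.cost j :=
    Finset.sum_nonneg fun j _ => I.cost_nonneg j
  simpa [agentUtility] using h

end ContractSetting

/-- `d` is a demand oracle for `f`: at every price vector `p` it returns a set that maximizes
`f S - ∑ j ∈ S, p j`.  Nothing is assumed on how ties are broken. -/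
def IsDemandOracle {m : ℕ} (f : Finset (Fin m) → ℝ)
    (d : (Fin m → ℝ) → Finset (Fin m)) : Prop :=
  ∀ (p : Fin m → ℝ) (S : Finset (Fin m)), f S - ∑ j ∈ S, p j ≤ f (d p) - ∑ j ∈ d p, p j

/-! ### Real random access machines with value and demand oracles

Programs are finite while-programs.  The memory consists of arrays of natural numbers (for indices,
counters and sets of actions) and arrays of real numbers.  Natural numbers can be added, subtracted
(with truncation at `0`) and compared; real numbers can be added, subtracted, multiplied, divided
and compared exactly, and square roots can be taken.  The only constants are natural numbers, and
there is no rounding of real numbers to integers. -/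

namespace RealRAM

/-- The memory: array `a` of natural numbers has the entries `nat a 0, nat a 1, …`, and likewise
for the arrays of real numbers. -/
structure State where
  nat : ℕ → ℕ → ℕ
  real : ℕ → ℕ → ℝ

/-- Write `v` into entry `i` of array `a` of natural numbers. -/
def State.setNat (s : State) (a i v : ℕ) : State :=
  { s with nat := Function.update s.nat a (Function.update (s.nat a) i v) }

/-- Write `x` into entry `i` of array `a` of real numbers. -/
def State.setReal (s : State) (a i : ℕ) (x : ℝ) : State :=
  { s with real := Function.update s.real a (Function.update (s.real a) i x) }

/-- Natural-number expressions; `get a i` is entry `i` of array `a`. -/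
inductive NatExp where
  | lit (k : ℕ)
  | get (a : ℕ) (i : NatExp)
  | add (x y : NatExp)
  | sub (x y : NatExp)

/-- Real expressions; `ofNat e` converts a natural number to a real number. -/
inductive RealExp where
  | ofNat (e : NatExp)
  | get (a : ℕ) (i : NatExp)
  | add (x y : RealExp)
  | sub (x y : RealExp)
  | mul (x y : RealExp)
  | div (x y : RealExp)
  | sqrt (x : RealExp)

/-- Tests. -/
inductive Test where
  | natLe (x y : NatExp)
  | realLe (x y : RealExp)
  | neg (b : Test)
  | conj (b c : Test)

namespace NatExp

def eval (s : State) : NatExp → ℕ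
  | lit k => k
  | get a i => s.nat a (i.eval s)
  | add x y => x.eval s + y.eval s
  | sub x y => x.eval s - y.eval s

/-- The number of elementary operations of one evaluation. -/
def size : NatExp → ℕ
  | lit _ => 1
  | get _ i => i.size + 1
  | add x y => x.size + y.size + 1
  | sub x y => x.size + y.size + 1

end NatExp

namespace RealExp

/-- Division by `0` returns `0`, and so does the square root of a negative number. -/
noncomputable def eval (s : State) : RealExp → ℝ
  | ofNat e => (e.eval s : ℝ)
  | get a i => s.real a (i.eval s)
  | add x y => x.eval s + y.eval s
  | sub x y => x.eval s - y.eval s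
  | mul x y => x.eval s * y.eval s
  | div x y => x.eval s / y.eval s
  | sqrt x => Real.sqrt (x.eval s)

/-- The number of elementary operations of one evaluation. -/
def size : RealExp → ℕ
  | ofNat e => e.size + 1
  | get _ i => i.size + 1
  | add x y => x.size + y.size + 1
  | sub x y => x.size + y.size + 1
  | mul x y => x.size + y.size + 1
  | div x y => x.size + y.size + 1
  | sqrt x => x.size + 1

end RealExp

namespace Test

def eval (s : State) : Test → Prop
  | natLe x y => x.eval s ≤ y.eval s
  | realLe x y => x.eval s ≤ y.eval s
  | neg b => ¬ b.eval s
  | conj b c => b.eval s ∧ c.eval s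

/-- The number of elementary operations of one evaluation. -/
def size : Test → ℕ
  | natLe x y => x.size + y.size + 1
  | realLe x y => x.size + y.size + 1
  | neg b => b.size + 1
  | conj b c => b.size + c.size + 1

end Test

/-- Programs. -/
inductive Program where
  | skip
  /-- Assign the value of `e` to entry `i` of array `a` of natural numbers. -/
  | assignNat (a : ℕ) (i e : NatExp)
  /-- Assign the value of `e` to entry `i` of array `a` of real numbers. -/
  | assignReal (a : ℕ) (i : NatExp) (e : RealExp)
  | seq (P Q : Program)
  | ite (b : Test) (P Q : Program)
  /-- Repeat `P` as long as `b` holds. -/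
  | loop (b : Test) (P : Program)
  /-- Query the value oracle at the set that array `q` of natural numbers encodes, and write the
  answer into entry `i` of array `a` of real numbers. -/
  | valueQuery (q : ℕ) (a : ℕ) (i : NatExp)
  /-- Query the demand oracle at the prices in array `p` of real numbers, and write the answer into
  array `a` of natural numbers. -/
  | demandQuery (p : ℕ) (a : ℕ)

/-- The set of actions that array `a` encodes: those whose entry is not `0`. -/
def State.readSet (m : ℕ) (s : State) (a : ℕ) : Finset (Fin m) :=
  Finset.univ.filter fun j => s.nat a j ≠ 0

/-- The vector in the first `k` entries of array `a`. -/
def State.readVec (k : ℕ) (s : State) (a : ℕ) : Fin k → ℝ :=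
  fun j => s.real a j

/-- Write the indicator vector of `S` into the first `m` entries of array `a`. -/
def State.writeSet {m : ℕ} (s : State) (a : ℕ) (S : Finset (Fin m)) : State :=
  { s with nat := Function.update s.nat a fun k =>
      if h : k < m then (if (⟨k, h⟩ : Fin m) ∈ S then 1 else 0) else s.nat a k }

/-- The cost of a run: the number of elementary steps, of value queries, and of demand queries. -/
abbrev RunCost := ℕ × ℕ × ℕ

/-- `Exec f d P s t s'`: with the value oracle `f` and the demand oracle `d`, the program `P`,
started in the state `s`, halts in the state `s'` at the cost `t`.  A query takes `m + 1` steps. -/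
inductive Exec {m : ℕ} (f : Finset (Fin m) → ℝ) (d : (Fin m → ℝ) → Finset (Fin m)) :
    Program → State → RunCost → State → Prop where
  | skip (s : State) : Exec f d .skip s (1, 0, 0) s
  | assignNat (s : State) (a : ℕ) (i e : NatExp) :
      Exec f d (.assignNat a i e) s (i.size + e.size + 1, 0, 0)
        (s.setNat a (i.eval s) (e.eval s))
  | assignReal (s : State) (a : ℕ) (i : NatExp) (e : RealExp) :
      Exec f d (.assignReal a i e) s (i.size + e.size + 1, 0, 0)
        (s.setReal a (i.eval s) (e.eval s))
  | seq {P Q : Program} {s s₁ s₂ : State} {t₁ t₂ : RunCost}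
      (hP : Exec f d P s t₁ s₁) (hQ : Exec f d Q s₁ t₂ s₂) :
      Exec f d (.seq P Q) s (t₁ + t₂) s₂
  | iteTrue {b : Test} {P Q : Program} {s s₁ : State} {t : RunCost}
      (hb : b.eval s) (hP : Exec f d P s t s₁) :
      Exec f d (.ite b P Q) s ((b.size + 1, 0, 0) + t) s₁
  | iteFalse {b : Test} {P Q : Program} {s s₁ : State} {t : RunCost}
      (hb : ¬ b.eval s) (hQ : Exec f d Q s t s₁) :
      Exec f d (.ite b P Q) s ((b.size + 1, 0, 0) + t) s₁
  | loopDone {b : Test} {P : Program} {s : State} (hb : ¬ b.eval s) :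
      Exec f d (.loop b P) s (b.size + 1, 0, 0) s
  | loopStep {b : Test} {P : Program} {s s₁ s₂ : State} {t₁ t₂ : RunCost}
      (hb : b.eval s) (hP : Exec f d P s t₁ s₁) (hL : Exec f d (.loop b P) s₁ t₂ s₂) :
      Exec f d (.loop b P) s ((b.size + 1, 0, 0) + t₁ + t₂) s₂
  | valueQuery (s : State) (q a : ℕ) (i : NatExp) :
      Exec f d (.valueQuery q a i) s (i.size + m + 1, 1, 0)
        (s.setReal a (i.eval s) (f (s.readSet m q)))
  | demandQuery (s : State) (p a : ℕ) :
      Exec f d (.demandQuery p a) s (m + 1, 0, 1) (s.writeSet a (d (s.readVec m p)))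

/-- The initial state.  Array `0` of natural numbers holds `n, m`, array `1` the agents of the
actions; array `0` of real numbers holds the costs of the actions, array `1` the reward.  All other
entries are `0`.  The function `f` is accessible through the oracles only. -/
def input {n m : ℕ} (I : ContractSetting n m) : State where
  nat a k :=
    if a = 0 then (if k = 0 then n else if k = 1 then m else 0)
    else if a = 1 then (if h : k < m then (I.agent ⟨k, h⟩ : ℕ) else 0)
    else 0
  real a k :=
    if a = 0 then (if h : k < m then I.cost ⟨k, h⟩ else 0)
    else if a = 1 then (if k = 0 then I.reward else 0)
    else 0

/-- The contract that a program outputs: the first `n` entries of array `2` of real numbers. -/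
def output (n : ℕ) (s : State) : Fin n → ℝ :=
  s.readVec n 2

end RealRAM

/-! ### Submodular success probabilities -/

namespace ContractSetting

variable {n m : ℕ} {I : ContractSetting n m}

/-! Write `r` for the reward. Fix an equilibrium `S` of a contract `α`. If the shares total more
than 1, the principal gains nothing; otherwise at most 32 agents have a share above 1/32. By
subadditivity, `f S` is at most the value of the part of `S` owned by the other, small agents plus
the values of the parts of the big agents. These parts are charged to two contracts that can be
computed.

Small agents. The cost of an agent is at most its share of its marginal contribution to `S`, and the
marginal contributions add up to at most `f S`. Hence doubled shares, rounded to multiples of `1 /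
(16 * n)`, pay for the small part while using up at most half of its value
(`IsNash.affordable_filter`). A greedy algorithm buys, again and again, the agent and the share
increment with the best gain per share, each evaluated by one demand query. Its final set `T` is
within a constant factor of every affordable set, at a total share bounded away from 1/2
(`GreedyInv.step`, `GreedyInv.affordable_le`). Doubling the greedy shares makes the contract robust:
in an equilibrium no agent gains by adding its part of `T`, so by submodularity every equilibrium is
worth at least half of `T` (`IsNash.le_f`, `GreedyInv.contract`).

Big agents. The best response of one agent alone to a share `1 - y` is a demand query. The values `y
= W / f {j} / 2 ^ k` are tried for all actions `j` and linearly many `k`, where `W` is the welfare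
the agent can produce alone. The grid contains a `y` comparable to `1 - α i` unless the latter is
exponentially small; in that case a grid point that extracts only an exponentially small fraction of
`W` already suffices (`exists_welfare_le`). If `α i` is close to 1, all other agents are small and
their influence on agent `i` is charged to `T` (`IsNash.big_agent_le`).

Choice. `optUtility_le` bounds the optimum by a combination of the best grid value and `f T`. If `f
T` is not negligible, the greedy contract is good enough. Otherwise a single agent is paid, halfway
between the grid share and 1: unpaid agents take only free actions, which form an affordable set and
so matter little, and the extra pay makes every equilibrium nearly as valuable as the response
(`IsNash.three_mul_response_le`).

The remaining lemmas show that a program carries this out, with polynomial cost bounds attached to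
its specifications (`Runs`). -/

theorem IsSubmodular.marginal_anti (hI : I.IsSubmodular) {S T : Finset (Fin m)} (h : S ⊆ T)
    (U : Finset (Fin m)) : I.f (T ∪ U) - I.f T ≤ I.f (S ∪ U) - I.f S := by
  induction U using Finset.induction_on with
  | empty => simp
  | insert j U _ ih =>
    have := hI (S ∪ U) (T ∪ U) (Finset.union_subset_union_left h) j
    rw [Finset.union_assoc, Finset.union_assoc, Finset.union_comm U {j},
      ← Finset.insert_eq] at this
    linarith

theorem IsSubmodular.f_union_le (hI : I.IsSubmodular) (S T : Finset (Fin m)) :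
    I.f (S ∪ T) ≤ I.f S + I.f T := by
  have := hI.marginal_anti (Finset.empty_subset S) T
  simp only [Finset.empty_union, I.f_empty] at this
  linarith

/-- Each `U i` is added on top of a larger set than `S`, where it contributes no more. This turns a
joint deviation of all agents into separate ones. -/
theorem IsSubmodular.f_union_biUnion_sub_le (hI : I.IsSubmodular) {ι : Type*} [DecidableEq ι]
    (S : Finset (Fin m)) (J : Finset ι) (U : ι → Finset (Fin m)) :
    I.f (S ∪ J.biUnion U) - I.f S ≤ ∑ i ∈ J, (I.f (S ∪ U i) - I.f S) := by
  induction J using Finset.induction_on with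
  | empty => simp
  | insert i J hi ih =>
    rw [Finset.sum_insert hi, Finset.biUnion_insert]
    have := hI.marginal_anti (S := S) (T := S ∪ J.biUnion U) Finset.subset_union_left (U i)
    rw [Finset.union_comm (U i), ← Finset.union_assoc]
    linarith

theorem IsSubmodular.f_biUnion_le (hI : I.IsSubmodular) {ι : Type*} [DecidableEq ι]
    (J : Finset ι) (U : ι → Finset (Fin m)) :
    I.f (J.biUnion U) ≤ ∑ i ∈ J, I.f (U i) := by
  simpa [I.f_empty] using hI.f_union_biUnion_sub_le ∅ J U

theorem IsSubmodular.f_le_card_mul (hI : I.IsSubmodular) (S : Finset (Fin m)) {v : ℝ}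
    (hv0 : 0 ≤ v) (hv : ∀ j ∈ S, I.f {j} ≤ v) : I.f S ≤ m * v := by
  have h1 := hI.f_biUnion_le S fun j => {j}
  rw [Finset.biUnion_singleton_eq_self] at h1
  calc I.f S ≤ ∑ j ∈ S, I.f {j} := h1
    _ ≤ ∑ _j ∈ S, v := Finset.sum_le_sum hv
    _ = S.card * v := by simp
    _ ≤ m * v := by
      gcongr
      exact (Finset.card_le_univ S).trans_eq (Fintype.card_fin m)

/-- By subadditivity, the action of largest singleton value works. The unknown number `f S` is thus
located up to a factor `m` among `m` numbers that can be queried. -/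
theorem IsSubmodular.exists_mem_le_card_mul (hI : I.IsSubmodular) {S : Finset (Fin m)}
    (hS : 0 < I.f S) :
    ∃ j ∈ S, 0 < I.f {j} ∧ I.f {j} ≤ I.f S ∧ I.f S ≤ m * I.f {j} := by
  have hne : S.Nonempty := by
    rw [Finset.nonempty_iff_ne_empty]
    rintro rfl
    exact hS.ne' I.f_empty
  obtain ⟨j, hj, hmax⟩ := S.exists_max_image (fun j => I.f {j}) hne
  have h := hI.f_le_card_mul S (I.f_nonneg {j}) hmax
  refine ⟨j, hj, ?_, I.f_mono _ _ (by simpa using hj), h⟩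
  by_contra h0
  have : I.f {j} = 0 := le_antisymm (not_lt.1 h0) (I.f_nonneg _)
  rw [this, mul_zero] at h
  linarith

theorem mem_actions {i : Fin n} {j : Fin m} : j ∈ I.actions i ↔ I.agent j = i := by
  simp [actions]

theorem biUnion_inter_actions (S : Finset (Fin m)) :
    Finset.univ.biUnion (fun i => S ∩ I.actions i) = S := by
  ext j
  simp [mem_actions]

theorem sum_inter_actions (S : Finset (Fin m)) (g : Fin m → ℝ) :
    ∑ i, ∑ j ∈ S ∩ I.actions i, g j = ∑ j ∈ S, g j := by
  rw [← Finset.sum_fiberwise S I.agent g]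
  refine Finset.sum_congr rfl fun i _ => Finset.sum_congr ?_ fun _ _ => rfl
  ext j
  simp [mem_actions]

/-- The marginal contributions of the agents to `S` add up to at most `f S`. -/
theorem IsSubmodular.sum_sub_sdiff_le (hI : I.IsSubmodular) (S : Finset (Fin m))
    (J : Finset (Fin n)) : ∑ i ∈ J, (I.f S - I.f (S \ I.actions i)) ≤ I.f S := by
  suffices h : ∑ i ∈ J, (I.f S - I.f (S \ I.actions i)) ≤
      I.f S - I.f (S \ J.biUnion I.actions) from
    h.trans (by linarith [I.f_nonneg (S \ J.biUnion I.actions)])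
  induction J using Finset.induction_on with
  | empty => simp
  | insert i J hi ih =>
    rw [Finset.sum_insert hi, Finset.biUnion_insert]
    -- Removing the agents one after another telescopes: with the rest of `J` gone, dropping agent
    -- `i` loses at least its marginal contribution to `S`.
    have := hI.marginal_anti (S := S \ (I.actions i ∪ J.biUnion I.actions))
      (T := S \ I.actions i) (Finset.sdiff_subset_sdiff le_rfl Finset.subset_union_left)
      (S ∩ I.actions i)
    rw [Finset.sdiff_union_inter] at this
    have h2 : S \ (I.actions i ∪ J.biUnion I.actions) ∪ S ∩ I.actions i =
        S \ J.biUnion I.actions := by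
      ext j
      simp only [Finset.mem_union, Finset.mem_sdiff, Finset.mem_inter, Finset.mem_biUnion,
        mem_actions]
      by_cases h : I.agent j = i
      · subst h; simp [hi]
      · simp [h]
    rw [h2] at this
    linarith

/-! ### Equilibria -/

theorem IsNash.deviation {α : Fin n → ℝ} {S : Finset (Fin m)} (hS : I.IsNash α S) (i : Fin n)
    {T : Finset (Fin m)} (hT : T ⊆ I.actions i) :
    α i * I.f (T ∪ (S \ I.actions i)) * I.reward - ∑ j ∈ T, I.cost j ≤
      α i * I.f S * I.reward - ∑ j ∈ S ∩ I.actions i, I.cost j := by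
  have h := hS i T hT
  have h2 : (T ∪ (S \ I.actions i)) ∩ I.actions i = T := by
    ext j
    simp only [Finset.mem_union, Finset.mem_sdiff, Finset.mem_inter]
    have := @hT j
    tauto
  simpa [agentUtility, h2] using h

/-- Otherwise agent `i` would gain by dropping all of its actions. -/
theorem IsNash.cost_le {α : Fin n → ℝ} {S : Finset (Fin m)} (hS : I.IsNash α S) (i : Fin n) :
    ∑ j ∈ S ∩ I.actions i, I.cost j ≤
      α i * (I.f S - I.f (S \ I.actions i)) * I.reward := by
  have h := hS.deviation i (Finset.empty_subset _)
  simp only [Finset.empty_union, Finset.sum_empty] at h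
  linarith

theorem IsNash.cost_eq_zero {α : Fin n → ℝ} {S : Finset (Fin m)} (hS : I.IsNash α S) {j : Fin m}
    (hj : j ∈ S) (hα : α (I.agent j) = 0) : I.cost j = 0 := by
  have h := hS.cost_le (I.agent j)
  rw [hα, zero_mul, zero_mul] at h
  have h2 := Finset.single_le_sum (f := I.cost) (fun j _ => I.cost_nonneg j)
    (show j ∈ S ∩ I.actions (I.agent j) by simp [hj, mem_actions])
  linarith [I.cost_nonneg j]

/-- In every equilibrium of `γ`, the success probability is at least the value of every demand
problem whose prices are the costs divided by the shares of the agents. -/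
theorem IsNash.le_f (hI : I.IsSubmodular) {γ : Fin n → ℝ}
    {S : Finset (Fin m)} (hS : I.IsNash γ S) (T : Finset (Fin m))
    (hT : ∀ j ∈ T, 0 < γ (I.agent j)) :
    I.f T - ∑ j ∈ T, I.cost j / (γ (I.agent j) * I.reward) ≤ I.f S := by
  have h1 := hI.f_union_biUnion_sub_le S Finset.univ fun i => T ∩ I.actions i
  rw [biUnion_inter_actions] at h1
  have h2 : ∀ i, I.f (S ∪ T ∩ I.actions i) - I.f S ≤
      ∑ j ∈ T ∩ I.actions i, I.cost j / (γ (I.agent j) * I.reward) := by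
    intro i
    rcases (T ∩ I.actions i).eq_empty_or_nonempty with h | ⟨j₀, hj₀⟩
    · simp [h]
    have hγi : 0 < γ i := by
      have := hT j₀ (Finset.mem_inter.1 hj₀).1
      rwa [mem_actions.1 (Finset.mem_inter.1 hj₀).2] at this
    -- Agent `i` does not gain by adding its part of `T` to what it already does, so that part
    -- raises `f` by at most its price.
    have h3 := hS.deviation i (T := (S ∪ T) ∩ I.actions i) Finset.inter_subset_right
    have h4 : (S ∪ T) ∩ I.actions i ∪ S \ I.actions i = S ∪ T ∩ I.actions i := by
      ext j
      simp only [Finset.mem_union, Finset.mem_sdiff, Finset.mem_inter]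
      tauto
    have h5 : ∑ j ∈ (S ∪ T) ∩ I.actions i, I.cost j ≤
        ∑ j ∈ S ∩ I.actions i, I.cost j + ∑ j ∈ T ∩ I.actions i, I.cost j := by
      rw [Finset.union_inter_distrib_right, ← Finset.sum_union_inter]
      exact le_add_of_nonneg_right (Finset.sum_nonneg fun j _ => I.cost_nonneg j)
    have h6 : ∑ j ∈ T ∩ I.actions i, I.cost j / (γ (I.agent j) * I.reward) =
        (∑ j ∈ T ∩ I.actions i, I.cost j) / (γ i * I.reward) := by
      rw [Finset.sum_div]
      refine Finset.sum_congr rfl fun j hj => ?_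
      rw [mem_actions.1 (Finset.mem_inter.1 hj).2]
    rw [h6, le_div_iff₀ (mul_pos hγi I.reward_pos)]
    rw [h4] at h3
    nlinarith
  have h3 := h1.trans (Finset.sum_le_sum fun i _ => h2 i)
  rw [sum_inter_actions] at h3
  linarith [I.f_mono T (S ∪ T) Finset.subset_union_right]

end ContractSetting

namespace ContractSetting

variable {n m : ℕ} {I : ContractSetting n m}

/-! ### Demand queries for single agents -/

/-- The prices that restrict a demand query to supersets of `T` by actions of agent `i`, whose
costs are scaled by `s`. -/
noncomputable def demandPrice (I : ContractSetting n m) (T : Finset (Fin m)) (i : ℕ) (s : ℝ) :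
    Fin m → ℝ :=
  fun j => if j ∈ T then 0 else if (I.agent j : ℕ) = i then I.cost j * s else 2

/-- The extension of `T` by actions of agent `i` that the demand oracle selects. -/
noncomputable def demandSet (I : ContractSetting n m) (d : (Fin m → ℝ) → Finset (Fin m))
    (T : Finset (Fin m)) (i : ℕ) (s : ℝ) : Finset (Fin m) :=
  T ∪ d (I.demandPrice T i s)

/-- The value of the selected extension. -/
noncomputable def demandValue (I : ContractSetting n m) (d : (Fin m → ℝ) → Finset (Fin m))
    (T : Finset (Fin m)) (i : ℕ) (s : ℝ) : ℝ :=
  I.f (I.demandSet d T i s) - ∑ j ∈ I.demandSet d T i s, I.demandPrice T i s j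

variable {d : (Fin m → ℝ) → Finset (Fin m)} {T : Finset (Fin m)} {s : ℝ}

theorem demandPrice_nonneg (hs : 0 ≤ s) (i : ℕ) (j : Fin m) : 0 ≤ I.demandPrice T i s j := by
  have := I.cost_nonneg j
  unfold demandPrice
  split_ifs <;> positivity

theorem sum_demandPrice_union (U : Finset (Fin m)) (i : ℕ) :
    ∑ j ∈ T ∪ U, I.demandPrice T i s j = ∑ j ∈ U, I.demandPrice T i s j := by
  symm
  refine Finset.sum_subset Finset.subset_union_right fun j hj hjU => ?_
  have : j ∈ T := (Finset.mem_union.1 hj).resolve_right hjU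
  simp [demandPrice, this]

/-- Adding `T` to the answer of the oracle is free and does not decrease `f`. -/
theorem le_demandValue (hd : IsDemandOracle I.f d) (i : ℕ) (U : Finset (Fin m)) :
    I.f U - ∑ j ∈ U, I.demandPrice T i s j ≤ I.demandValue d T i s := by
  have h := hd (I.demandPrice T i s) U
  have h2 := I.f_mono (d (I.demandPrice T i s)) (T ∪ d (I.demandPrice T i s))
    Finset.subset_union_right
  rw [demandValue, demandSet, sum_demandPrice_union]
  linarith

theorem subset_demandSet (i : ℕ) : T ⊆ I.demandSet d T i s := Finset.subset_union_left

theorem f_le_demandValue (hd : IsDemandOracle I.f d) (i : ℕ) :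
    I.f T ≤ I.demandValue d T i s := by
  have h := le_demandValue (T := T) (s := s) hd i T
  rw [Finset.sum_eq_zero fun j hj => by simp [demandPrice, hj]] at h
  linarith

/-- A single action of price 2 outweighs `f ≤ 1`, whereas the demand value is nonnegative. So this
holds however the oracle breaks ties. -/
theorem agent_eq_of_mem_demandSet (hd : IsDemandOracle I.f d) (hs : 0 ≤ s) {i : ℕ} {j : Fin m}
    (hj : j ∈ I.demandSet d T i s) (hjT : j ∉ T) : (I.agent j : ℕ) = i := by
  by_contra hne
  have h1 : I.demandPrice T i s j = 2 := by simp [demandPrice, hjT, hne]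
  have h2 := Finset.single_le_sum (f := I.demandPrice T i s)
    (fun j _ => demandPrice_nonneg hs i j) hj
  have h3 := f_le_demandValue (T := T) (s := s) hd i
  have h4 := I.f_le_one (I.demandSet d T i s)
  have h5 := I.f_nonneg T
  rw [demandValue] at h3
  linarith

theorem sum_demandPrice_demandSet (hd : IsDemandOracle I.f d) (hs : 0 ≤ s) (i : ℕ) :
    ∑ j ∈ I.demandSet d T i s, I.demandPrice T i s j =
      ∑ j ∈ I.demandSet d T i s \ T, I.cost j * s := by
  rw [← Finset.sum_sdiff (subset_demandSet i),
    Finset.sum_eq_zero (s := T) fun j hj => by simp [demandPrice, hj], add_zero]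
  refine Finset.sum_congr rfl fun j hj => ?_
  obtain ⟨hj, hjT⟩ := Finset.mem_sdiff.1 hj
  simp [demandPrice, hjT, agent_eq_of_mem_demandSet hd hs hj hjT]

theorem union_le_demandValue (hd : IsDemandOracle I.f d) (hs : 0 ≤ s) (i : Fin n)
    {U : Finset (Fin m)} (hU : U ⊆ I.actions i) :
    I.f (T ∪ U) - s * ∑ j ∈ U, I.cost j ≤ I.demandValue d T i s := by
  refine le_trans ?_ (le_demandValue hd i (T ∪ U))
  rw [sum_demandPrice_union, Finset.mul_sum]
  gcongr with j hj
  have := mul_nonneg (I.cost_nonneg j) hs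
  have h : (I.agent j : ℕ) = i := by rw [mem_actions.1 (hU hj)]
  unfold demandPrice
  split_ifs <;> linarith

/-! ### A single incentivized agent -/

/-- The best response of agent `i` alone to the share `a`. -/
noncomputable def response (I : ContractSetting n m) (d : (Fin m → ℝ) → Finset (Fin m))
    (i : ℕ) (a : ℝ) : Finset (Fin m) :=
  I.demandSet d ∅ i (1 / (a * I.reward))

/-- The welfare that agent `i` alone can produce, in units of the reward. -/
noncomputable def welfare (I : ContractSetting n m) (d : (Fin m → ℝ) → Finset (Fin m))
    (i : ℕ) : ℝ :=
  I.demandValue d ∅ i (1 / I.reward)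

theorem response_subset (hd : IsDemandOracle I.f d) {a : ℝ} (ha : 0 ≤ a) (i : Fin n) :
    I.response d i a ⊆ I.actions i := fun j hj => by
  have hr := I.reward_pos
  exact mem_actions.2 (Fin.ext (agent_eq_of_mem_demandSet hd (by positivity) hj (by simp)))

/-- Optimality of the demand query at the prices `c_j / (a * r)`, multiplied by `a * r`. -/
theorem le_response (hd : IsDemandOracle I.f d) {a : ℝ} (ha : 0 < a) (i : Fin n)
    {U : Finset (Fin m)} (hU : U ⊆ I.actions i) :
    a * I.f U * I.reward - ∑ j ∈ U, I.cost j ≤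
      a * I.f (I.response d i a) * I.reward - ∑ j ∈ I.response d i a, I.cost j := by
  have hr := I.reward_pos
  have h := union_le_demandValue (T := ∅) (s := 1 / (a * I.reward)) hd (by positivity) i hU
  rw [demandValue, sum_demandPrice_demandSet hd (by positivity), ← Finset.sum_mul,
    Finset.sdiff_empty, Finset.empty_union] at h
  have h2 := mul_le_mul_of_nonneg_left h (mul_pos ha hr).le
  have h3 : a * I.reward * (1 / (a * I.reward)) = 1 := by field_simp
  unfold response
  linear_combination h2 + (∑ j ∈ U, I.cost j -
    ∑ j ∈ I.demandSet d ∅ i (1 / (a * I.reward)), I.cost j) * h3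

theorem welfare_eq (hd : IsDemandOracle I.f d) (i : Fin n) :
    I.welfare d i * I.reward =
      I.f (I.response d i 1) * I.reward - ∑ j ∈ I.response d i 1, I.cost j := by
  have hr := I.reward_pos
  rw [welfare, demandValue, sum_demandPrice_demandSet hd (by positivity), ← Finset.sum_mul,
    Finset.sdiff_empty, response, one_mul]
  field_simp

theorem le_welfare (hd : IsDemandOracle I.f d) (i : Fin n)
    {U : Finset (Fin m)} (hU : U ⊆ I.actions i) :
    I.f U * I.reward - ∑ j ∈ U, I.cost j ≤ I.welfare d i * I.reward := by
  simpa [welfare_eq hd] using le_response hd one_pos i hU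

theorem welfare_nonneg (hd : IsDemandOracle I.f d) (i : ℕ) : 0 ≤ I.welfare d i := by
  simpa only [I.f_empty, welfare] using f_le_demandValue (T := ∅) (s := 1 / I.reward) hd i

/-- The share of the reward that the principal keeps at the grid point `(j, k)` of agent `i`. -/
noncomputable def gridShare (I : ContractSetting n m) (d : (Fin m → ℝ) → Finset (Fin m))
    (i : ℕ) (j : Fin m) (k : ℕ) : ℝ :=
  I.welfare d i / I.f {j} / 2 ^ k

theorem gridShare_nonneg (hd : IsDemandOracle I.f d) (i : ℕ) (j : Fin m) (k : ℕ) :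
    0 ≤ I.gridShare d i j k := by
  have := welfare_nonneg hd i
  have := I.f_nonneg {j}
  unfold gridShare
  positivity

theorem two_mul_sq_le_two_pow (m : ℕ) : 2 * (m : ℝ) * m ≤ 2 ^ (2 * m + 1) := by
  have h : (m : ℝ) ≤ 2 ^ m := by exact_mod_cast m.lt_two_pow_self.le
  calc 2 * (m : ℝ) * m ≤ 2 * 2 ^ m * 2 ^ m := by gcongr
    _ = 2 ^ (2 * m + 1) := by ring

/-- Some grid point extracts a fraction `2 ^ (-(2 * m + 1))` of the welfare of agent `i`. -/
theorem exists_welfare_le (hI : I.IsSubmodular) (hd : IsDemandOracle I.f d) (i : Fin n)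
    (hW : 0 < I.welfare d i) :
    ∃ j, I.gridShare d i j (2 * m + 1) < 1 ∧ I.welfare d i / 2 ^ (2 * m + 1) ≤
      I.gridShare d i j (2 * m + 1) *
        I.f (I.response d i (1 - I.gridShare d i j (2 * m + 1))) := by
  classical
  set W := I.welfare d i with hWdef
  have hr := I.reward_pos
  set y : Fin m → ℝ := fun j => I.gridShare d i j (2 * m + 1) with hy
  have hy0 : ∀ j, 0 ≤ y j := fun j => gridShare_nonneg hd i j _
  -- `N v` measures the progress of a descent to ever smaller singleton values. It takes at most `m`
  -- steps, each of which may lose `W / (2 * m)`, so half of the welfare always remains.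
  set N : ℝ → ℕ := fun v => (Finset.univ.filter fun j : Fin m => v ≤ I.f {j}).card with hN
  have hNm : ∀ v, N v ≤ m := fun v => (Finset.card_le_univ _).trans_eq (Fintype.card_fin m)
  let C : Finset (Fin m) := Finset.univ.filter fun j => 0 < I.f {j} ∧ y j < 1 ∧
    ∃ U ⊆ I.actions i, W * (1 - N (I.f {j}) / (2 * m)) * I.reward ≤
      (1 - y j) * I.f U * I.reward - ∑ j ∈ U, I.cost j
  -- One step of the descent: the action `j` of largest singleton value in `U` joins `C`, since `y j
  -- * f U ≤ y j * m * f {j} = W * m / 2 ^ (2 * m + 1) ≤ W / (2 * m)`.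
  have step : ∀ (t : ℕ) (b : ℝ) (U : Finset (Fin m)), t < m → b ≤ 1 → U ⊆ I.actions i →
      W * (1 - t / (2 * m)) * I.reward ≤ b * I.f U * I.reward - ∑ j ∈ U, I.cost j →
      ∃ j ∈ U, I.f U ≤ m * I.f {j} ∧ 0 < I.f {j} ∧ (t + 1 ≤ N (I.f {j}) → j ∈ C) := by
    intro t b U ht hb hU h
    have hm : (0 : ℝ) < m := by exact_mod_cast (Nat.zero_le t).trans_lt ht
    have hc : 0 ≤ ∑ j ∈ U, I.cost j := Finset.sum_nonneg fun j _ => I.cost_nonneg j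
    have hfrac : ∀ t : ℕ, t ≤ m → 0 < W * (1 - t / (2 * m)) * I.reward := by
      intro t ht
      have : (t : ℝ) ≤ m := by exact_mod_cast ht
      have : (t : ℝ) / (2 * m) < 1 := by rw [div_lt_one (by positivity)]; linarith
      have : 0 < 1 - (t : ℝ) / (2 * m) := by linarith
      positivity
    have hfU : 0 < I.f U := by
      by_contra h0
      have h1 : I.f U = 0 := le_antisymm (not_lt.1 h0) (I.f_nonneg U)
      have := hfrac t ht.le
      rw [h1] at h
      linarith
    obtain ⟨j, hj, hj0, -, hjm⟩ := hI.exists_mem_le_card_mul hfU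
    refine ⟨j, hj, hjm, hj0, fun htN => ?_⟩
    have hyU : y j * I.f U ≤ W / (2 * m) := by
      calc y j * I.f U ≤ y j * (m * I.f {j}) := by gcongr; exact hy0 j
        _ = W * m / 2 ^ (2 * m + 1) := by
          simp only [hy, gridShare, ← hWdef]
          field_simp
        _ ≤ W / (2 * m) := by
          rw [div_le_div_iff₀ (by positivity) (by positivity)]
          have := two_mul_sq_le_two_pow m
          nlinarith
    have hval : W * (1 - N (I.f {j}) / (2 * m)) * I.reward ≤
        (1 - y j) * I.f U * I.reward - ∑ j ∈ U, I.cost j := by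
      have h1 : (t : ℝ) + 1 ≤ N (I.f {j}) := by exact_mod_cast htN
      have h2 : ((t : ℝ) + 1) / (2 * m) ≤ N (I.f {j}) / (2 * m) := by gcongr
      have h3 : W * (1 - N (I.f {j}) / (2 * m)) ≤ W * (1 - t / (2 * m)) - W / (2 * m) := by
        have := mul_le_mul_of_nonneg_left h2 hW.le
        have h4 : W * (((t : ℝ) + 1) / (2 * m)) = W * (t / (2 * m)) + W / (2 * m) := by ring
        linarith
      have h4 : b * I.f U ≤ I.f U := by nlinarith
      have h5 : W * (1 - N (I.f {j}) / (2 * m)) * I.reward ≤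
        (W * (1 - t / (2 * m)) - W / (2 * m)) * I.reward := by gcongr
      have h6 : y j * I.f U * I.reward ≤ W / (2 * m) * I.reward := by gcongr
      have h7 : b * I.f U * I.reward ≤ I.f U * I.reward := by gcongr
      linarith
    refine Finset.mem_filter.2 ⟨Finset.mem_univ _, hj0, ?_, U, hU, hval⟩
    by_contra hy1
    have h1 := hfrac _ (hNm (I.f {j}))
    have h2 : (1 - y j) * I.f U * I.reward ≤ 0 := by
      have : 0 ≤ (y j - 1) * I.f U * I.reward := by
        have : 0 ≤ y j - 1 := by linarith
        positivity
      linarith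
    linarith
  have hNpos : ∀ j, 1 ≤ N (I.f {j}) := fun j => Finset.card_pos.2 ⟨j, by simp⟩
  have hCne : C.Nonempty := by
    have h1 := welfare_eq hd i
    rw [← hWdef] at h1
    have hm : 0 < m := by
      rcases Nat.eq_zero_or_pos m with rfl | hm
      · have : I.response d i 1 = ∅ := Finset.eq_empty_of_isEmpty _
        rw [this, I.f_empty] at h1
        have := mul_pos hW hr
        simp at h1
        rcases h1 with h1 | h1 <;> linarith
      · exact hm
    obtain ⟨j, -, -, -, hj⟩ := step 0 1 (I.response d i 1) hm le_rfl
      (response_subset hd zero_le_one i) (by simp [← h1])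
    exact ⟨j, hj (by simpa using hNpos j)⟩
  -- The descent ends at a minimal action of `C`: if the response to its grid share were worth less
  -- than `f {j}`, all actions in the response would have smaller singleton values, and one of them
  -- would be in `C`.
  obtain ⟨j, hj, hmin⟩ := C.exists_min_image (fun j => I.f {j}) hCne
  obtain ⟨-, hj0, hy1, U, hU, hval⟩ := Finset.mem_filter.1 hj
  refine ⟨j, hy1, ?_⟩
  have hresp := le_response hd (a := 1 - y j) (by linarith) i hU
  set D := I.response d i (1 - y j) with hD
  have hDA : D ⊆ I.actions i := response_subset hd (by linarith) i
  have hgoal : I.f {j} ≤ I.f D := by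
    by_contra hlt
    have hsub : ∀ j' ∈ D, I.f {j'} < I.f {j} := fun j' hj' =>
      (I.f_mono _ _ (by simpa using hj')).trans_lt (not_le.1 hlt)
    have hNlt : ∀ j', I.f {j'} < I.f {j} → N (I.f {j}) + 1 ≤ N (I.f {j'}) := by
      intro j' hj'
      refine Finset.card_lt_card ⟨fun x hx => ?_, fun h => ?_⟩
      · simp only [Finset.mem_filter, Finset.mem_univ, true_and] at hx ⊢
        linarith
      · have := @h j' (by simp)
        simp only [Finset.mem_filter, Finset.mem_univ, true_and] at this
        linarith
    -- If no singleton value is smaller than `f {j}`, then `D` is empty, although agent `i` can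
    -- still obtain half of the welfare.
    have hNj : N (I.f {j}) < m := by
      by_contra hge
      have hNeq : N (I.f {j}) = m := le_antisymm (hNm _) (not_lt.1 hge)
      have hm : (0 : ℝ) < m := by exact_mod_cast j.pos
      have hDe : D = ∅ := by
        rw [Finset.eq_empty_iff_forall_notMem]
        intro j' hj'
        have := hNlt j' (hsub j' hj')
        have := hNm (I.f {j'})
        omega
      rw [hDe, I.f_empty] at hresp
      have h1 : 0 < W * (1 - N (I.f {j}) / (2 * m)) * I.reward := by
        rw [hNeq]
        have : (m : ℝ) / (2 * m) = 1 / 2 := by field_simp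
        rw [this]
        positivity
      simp only [mul_zero, zero_mul, Finset.sum_empty, sub_zero] at hresp
      linarith
    obtain ⟨j', hj', -, -, hC⟩ := step (N (I.f {j})) (1 - y j) D hNj (by linarith [hy0 j]) hDA
      (hval.trans hresp)
    have := hmin j' (hC (hNlt j' (hsub j' hj')))
    linarith [hsub j' hj']
  calc W / 2 ^ (2 * m + 1) = y j * I.f {j} := by
        simp only [hy, gridShare, ← hWdef]
        field_simp
    _ ≤ y j * I.f D := by gcongr; exact hy0 j

end ContractSetting

namespace ContractSetting

variable {n m : ℕ} {I : ContractSetting n m} {d : (Fin m → ℝ) → Finset (Fin m)}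

/-! ### The two upper bounds -/

/-- A set is affordable if shares that are multiples of `1 / (16 * n)`, are at most `1 / 8`, and
have total at most `3`, pay for it while using up at most half of its value. -/
def Affordable (I : ContractSetting n m) (S : Finset (Fin m)) : Prop :=
  ∃ k : Fin n → ℕ, (∀ i, 1 ≤ k i ∧ k i ≤ 2 * n) ∧ ∑ i, k i ≤ 48 * n ∧
    ∑ j ∈ S, I.cost j * (16 * n / (k (I.agent j) * I.reward)) ≤ I.f S / 2

/-- Through this, the greedy set bounds what unpaid agents can contribute to an equilibrium. -/
theorem affordable_of_cost_eq_zero {S : Finset (Fin m)} (hS : ∀ j ∈ S, I.cost j = 0) :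
    I.Affordable S := by
  refine ⟨fun _ => 1, fun i => ⟨le_rfl, ?_⟩, ?_, ?_⟩
  · have := i.pos
    change 1 ≤ 2 * n
    omega
  · simp
    omega
  · rw [Finset.sum_eq_zero fun j hj => by rw [hS j hj, zero_mul]]
    linarith [I.f_nonneg S]

/-- The part of an equilibrium that belongs to agents with small shares is affordable. -/
theorem IsNash.affordable_filter (hI : I.IsSubmodular) {α : Fin n → ℝ} (hα : IsContract α)
    (hsum : ∑ i, α i ≤ 1) {S : Finset (Fin m)} (hS : I.IsNash α S) :
    I.Affordable (S.filter fun j => α (I.agent j) ≤ 1 / 32) := by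
  classical
  have hr := I.reward_pos
  set S' := S.filter fun j => α (I.agent j) ≤ 1 / 32 with hS'
  -- The doubled share `2 * α i` in units of `1 / (16 * n)`, rounded to the next larger integer.
  -- Doubling leaves half of the value unspent; rounding adds at most 1 per agent. Big agents own
  -- nothing in `S'`.
  let k : Fin n → ℕ := fun i => if α i ≤ 1 / 32 then ⌊32 * n * α i⌋₊ + 1 else 1
  have hk1 : ∀ i, 1 ≤ k i := fun i => by simp only [k]; split_ifs <;> omega
  have hkle : ∀ i, (k i : ℝ) ≤ 32 * n * α i + 1 := by
    intro i
    have h0 : 0 ≤ 32 * n * α i := by have := (hα i).1; positivity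
    simp only [k]
    split_ifs
    · push_cast
      linarith [Nat.floor_le h0]
    · push_cast
      linarith
  refine ⟨k, fun i => ⟨hk1 i, ?_⟩, ?_, ?_⟩
  · have hn : (1 : ℝ) ≤ n := by exact_mod_cast i.pos
    have h1 : (k i : ℝ) ≤ 2 * n := by
      by_cases h : α i ≤ 1 / 32
      · have := hkle i
        nlinarith
      · simp only [k, if_neg h]
        push_cast
        linarith
    exact_mod_cast h1
  · have h1 : ∑ i, (k i : ℝ) ≤ 48 * n := by
      calc ∑ i, (k i : ℝ) ≤ ∑ i, (32 * n * α i + 1) := Finset.sum_le_sum fun i _ => hkle i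
        _ = 32 * n * ∑ i, α i + n := by
          rw [Finset.sum_add_distrib, ← Finset.mul_sum]
          simp
        _ ≤ 32 * n * 1 + n := by gcongr
        _ ≤ 48 * n := by linarith [(Nat.cast_nonneg n : (0 : ℝ) ≤ n)]
    exact_mod_cast h1
  · rw [← sum_inter_actions]
    have h1 : ∀ i, ∑ j ∈ S' ∩ I.actions i,
        I.cost j * (16 * n / (k (I.agent j) * I.reward)) ≤
          (I.f S' - I.f (S' \ I.actions i)) / 2 := by
      intro i
      have hmono := I.f_mono (S' \ I.actions i) S' Finset.sdiff_subset
      by_cases h : α i ≤ 1 / 32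
      · have hSi : S' ∩ I.actions i = S ∩ I.actions i := by
          ext j
          simp only [hS', Finset.mem_inter, Finset.mem_filter, mem_actions]
          constructor
          · tauto
          · rintro ⟨h1, rfl⟩
            exact ⟨⟨h1, h⟩, rfl⟩
        have hc := hS.cost_le i
        have hkpos : (0 : ℝ) < k i := by exact_mod_cast hk1 i
        have hkge : 32 * n * α i ≤ k i := by
          simp only [k, if_pos h]
          push_cast
          exact (Nat.lt_floor_add_one _).le
        -- With the big agents removed, agent `i` contributes at least as much as before.
        have hmarg : I.f S - I.f (S \ I.actions i) ≤ I.f S' - I.f (S' \ I.actions i) := by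
          have := hI.marginal_anti (S := S' \ I.actions i) (T := S \ I.actions i)
            (Finset.sdiff_subset_sdiff (Finset.filter_subset _ _) le_rfl) (S ∩ I.actions i)
          rwa [Finset.sdiff_union_inter, ← hSi, Finset.sdiff_union_inter] at this
        have hmono2 := I.f_mono (S \ I.actions i) S Finset.sdiff_subset
        have hs : ∑ j ∈ S' ∩ I.actions i,
            I.cost j * (16 * n / (k (I.agent j) * I.reward)) =
              (∑ j ∈ S ∩ I.actions i, I.cost j) * (16 * n) / (k i * I.reward) := by
          rw [hSi, Finset.sum_mul, Finset.sum_div]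
          refine Finset.sum_congr rfl fun j hj => ?_
          rw [mem_actions.1 (Finset.mem_inter.1 hj).2]
          ring
        rw [hs, div_le_iff₀ (by positivity)]
        calc (∑ j ∈ S ∩ I.actions i, I.cost j) * (16 * n)
            ≤ (α i * (I.f S - I.f (S \ I.actions i)) * I.reward) * (16 * n) := by gcongr
          _ = 32 * n * α i * ((I.f S - I.f (S \ I.actions i)) * I.reward / 2) := by ring
          _ ≤ k i * ((I.f S - I.f (S \ I.actions i)) * I.reward / 2) := by
            gcongr
          _ ≤ k i * ((I.f S' - I.f (S' \ I.actions i)) * I.reward / 2) := by gcongr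
          _ = _ := by ring
      · have hSi : S' ∩ I.actions i = ∅ := by
          rw [Finset.eq_empty_iff_forall_notMem]
          intro j hj
          simp only [hS', Finset.mem_inter, Finset.mem_filter, mem_actions] at hj
          exact h (hj.2 ▸ hj.1.2)
        rw [hSi, Finset.sum_empty]
        linarith
    refine (Finset.sum_le_sum fun i _ => h1 i).trans ?_
    rw [← Finset.sum_div]
    linarith [hI.sum_sub_sdiff_le S' Finset.univ]

/-- `M` bounds the value of every point of the grid of shares. -/
def GridBound (I : ContractSetting n m) (d : (Fin m → ℝ) → Finset (Fin m)) (M : ℝ) : Prop :=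
  ∀ (i : Fin n) (j : Fin m), ∀ k < 3 * m + 4, I.gridShare d i j k < 1 →
    I.gridShare d i j k * I.f (I.response d i (1 - I.gridShare d i j k)) ≤ M

/-- The value of an agent with a large share is covered by the two bounds. -/
theorem IsNash.big_agent_le (hI : I.IsSubmodular) (hd : IsDemandOracle I.f d) {M₁ M₂ : ℝ}
    (h₁ : I.GridBound d M₁) (hM₁ : 0 ≤ M₁) (h₂ : ∀ S, I.Affordable S → I.f S ≤ 96 * M₂)
    (hM₂ : 0 ≤ M₂)
    {α : Fin n → ℝ} (hα : IsContract α) (hsum : ∑ i, α i ≤ 1)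
    {S : Finset (Fin m)} (hS : I.IsNash α S) (i : Fin n) (hi : 1 / 32 < α i) :
    (1 - α i) * I.f (S ∩ I.actions i) ≤ 256 * M₁ + 192 * M₂ := by
  have hr := I.reward_pos
  set X := S ∩ I.actions i with hX
  have hXA : X ⊆ I.actions i := Finset.inter_subset_right
  have hfX := I.f_nonneg X
  rcases (hα i).2.eq_or_lt with h1 | h1
  · rw [h1, sub_self, zero_mul]
    positivity
  rcases hfX.eq_or_lt with h0 | h0
  · rw [← h0, mul_zero]
    positivity
  obtain ⟨j, -, hj0, hjX, hjm⟩ := hI.exists_mem_le_card_mul h0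
  have hcost : ∑ j ∈ X, I.cost j ≤ α i * I.f X * I.reward := by
    refine (hS.cost_le i).trans ?_
    have := hI.marginal_anti (Finset.empty_subset (S \ I.actions i)) X
    rw [Finset.sdiff_union_inter, Finset.empty_union, I.f_empty, sub_zero] at this
    have := (hα i).1
    gcongr
  set W := I.welfare d i with hW
  have hXW : (1 - α i) * I.f X ≤ W := by
    have h2 := le_welfare hd i hXA
    have h3 : (1 - α i) * I.f X * I.reward ≤ W * I.reward := by linarith
    exact le_of_mul_le_mul_right h3 hr
  have hWpos : 0 < W := lt_of_lt_of_le (mul_pos (by linarith) h0) hXW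
  set y : ℕ → ℝ := fun k => I.gridShare d i j k with hy
  have hy0 : 1 - α i ≤ y 0 := by
    have : (1 - α i) * I.f {j} ≤ W := le_trans (by gcongr) hXW
    simp only [hy, gridShare, pow_zero, div_one]
    rwa [le_div_iff₀ hj0]
  have hysucc : ∀ k, y k = 2 * y (k + 1) := fun k => by
    simp only [hy, gridShare, pow_succ]
    field_simp
  have hex : ∃ k, y k ≤ (1 - α i) / 2 := by
    obtain ⟨k, hk⟩ := pow_unbounded_of_one_lt (W / I.f {j} / ((1 - α i) / 2)) one_lt_two
    refine ⟨k, ?_⟩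
    have h2 : 0 < (1 - α i) / 2 := by linarith
    rw [div_lt_iff₀ h2] at hk
    simp only [hy, gridShare, ← hW]
    rw [div_le_iff₀ (by positivity)]
    linarith
  classical
  -- The halving sequence starts at `1 - α i` or above, so its first term below `(1 - α i) / 2` is
  -- at least `(1 - α i) / 4`. The share `1 - y k` exceeds `α i` by at least half of `1 - α i`.
  obtain ⟨k, hk, hkmin⟩ : ∃ k, y k ≤ (1 - α i) / 2 ∧ (1 - α i) / 4 ≤ y k := by
    refine ⟨Nat.find hex, Nat.find_spec hex, ?_⟩
    rcases hc : Nat.find hex with _ | k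
    · linarith
    · have := Nat.find_min hex (m := k) (by omega)
      linarith [hysucc k]
  by_cases hkK : k < 3 * m + 4
  · have hM := h₁ i j k hkK (show y k < 1 by linarith [(hα i).1])
    change y k * I.f (I.response d i (1 - y k)) ≤ M₁ at hM
    set a := 1 - y k with ha
    set D := I.response d i a with hD
    have hfD := I.f_nonneg D
    have hDM : (1 - α i) * I.f D ≤ 4 * M₁ := by nlinarith
    have ha0 : 0 < a := by linarith [(hα i).1]
    have hresp := le_response hd ha0 i hXA
    have hDA : D ⊆ I.actions i := response_subset hd ha0.le i
    have hcD : 0 ≤ ∑ j ∈ D, I.cost j := Finset.sum_nonneg fun j _ => I.cost_nonneg j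
    by_cases hbig : α i ≤ 31 / 32
    -- The gap `a - α i` is at least 1/64 here, whence `f X ≤ 64 * f D`.
    · have h3 : (a - α i) * I.f X ≤ I.f D := by
        have h4 : (a - α i) * I.f X * I.reward ≤ I.f D * I.reward := by
          have : a * I.f D * I.reward ≤ 1 * I.f D * I.reward := by
            gcongr
            linarith [gridShare_nonneg hd i j k, (show I.gridShare d i j k = y k from rfl)]
          linarith
        exact le_of_mul_le_mul_right h4 hr
      have h5 : 1 / 64 * I.f X ≤ (a - α i) * I.f X := by
        gcongr
        linarith
      nlinarith
    -- The gap may be tiny here, but all other agents are small, so their part of `S` is worth at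
    -- most `96 * M₂`. Adding the optimality of `D` at the share `a` to the equilibrium condition at
    -- the share `α i` cancels the costs.
    · set R := S.filter fun j => α (I.agent j) ≤ 1 / 32 with hR
      have hRM := h₂ R (hS.affordable_filter hI hα hsum)
      have hrest : S \ I.actions i ⊆ R := by
        intro j hj
        obtain ⟨hjS, hji⟩ := Finset.mem_sdiff.1 hj
        rw [mem_actions] at hji
        refine Finset.mem_filter.2 ⟨hjS, ?_⟩
        have h3 : α (I.agent j) + α i ≤ ∑ i, α i := by
          rw [← Finset.sum_pair hji]
          exact Finset.sum_le_sum_of_subset_of_nonneg (Finset.subset_univ _)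
            fun i _ _ => (hα i).1
        linarith
      have hfrest := I.f_mono _ _ hrest
      have hdev := hS.deviation i hDA
      have hDS := I.f_mono D (D ∪ S \ I.actions i) Finset.subset_union_left
      have hSX : I.f S ≤ I.f X + I.f (S \ I.actions i) := by
        have := hI.f_union_le X (S \ I.actions i)
        rwa [Finset.union_comm, Finset.sdiff_union_inter] at this
      have h3 : (a - α i) * (I.f X - I.f D) ≤ 96 * M₂ := by
        have h4 : α i * I.f D * I.reward ≤ α i * I.f (D ∪ S \ I.actions i) * I.reward := by
          have := (hα i).1
          gcongr
        have h5 : α i * I.f S * I.reward ≤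
            α i * I.f X * I.reward + 96 * M₂ * I.reward := by
          have h6 : α i * I.f S ≤ α i * I.f X + 96 * M₂ := by nlinarith [(hα i).1]
          nlinarith
        have h6 : (a - α i) * (I.f X - I.f D) * I.reward ≤ 96 * M₂ * I.reward := by
          linarith
        exact le_of_mul_le_mul_right h6 hr
      have h7 : (1 - α i) / 2 ≤ a - α i := by linarith
      rcases le_total (I.f X) (I.f D) with h8 | h8
      · nlinarith
      · nlinarith
  -- The grid ends too early, so `1 - α i` is tiny and any grid point that extracts `W / 2 ^ (2 * m
  -- + 1)` suffices. In `3 * m + 4 = (2 * m + 1) + m + 3`, the `m` absorbs the factor between `f X`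
  -- and `f {j}`, and the 3 absorbs a factor 4 with a half to spare.
  · obtain ⟨j', hj'1, hj'⟩ := exists_welfare_le hI hd i hWpos
    have hM := hj'.trans (h₁ i j' (2 * m + 1) (by omega) hj'1)
    have h3 : (1 - α i) ≤ 4 * (W / I.f {j} / 2 ^ (3 * m + 4)) := by
      have : y k ≤ W / I.f {j} / 2 ^ (3 * m + 4) := by
        simp only [hy, gridShare, ← hW]
        gcongr
        · exact one_le_two
        · omega
      linarith
    have hm2 : (m : ℝ) ≤ 2 ^ m := by exact_mod_cast m.lt_two_pow_self.le
    calc (1 - α i) * I.f X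
        ≤ 4 * (W / I.f {j} / 2 ^ (3 * m + 4)) * (m * I.f {j}) := by gcongr
      _ = 4 * W * m / 2 ^ (3 * m + 4) := by field_simp
      _ ≤ 4 * W * 2 ^ m / 2 ^ (3 * m + 4) := by gcongr
      _ = W / 2 ^ (2 * m + 1) / 2 := by
        rw [show 3 * m + 4 = (2 * m + 1) + m + 3 by ring, pow_add, pow_add]
        field_simp
        norm_num
      _ ≤ 256 * M₁ + 192 * M₂ := by
        have : 0 ≤ W / 2 ^ (2 * m + 1) := by positivity
        rw [← hW] at hM
        linarith

/-- The optimal utility of the principal is bounded by the two bounds. -/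
theorem optUtility_le (hI : I.IsSubmodular) (hd : IsDemandOracle I.f d) {M₁ M₂ : ℝ}
    (h₁ : I.GridBound d M₁) (hM₁ : 0 ≤ M₁) (h₂ : ∀ S, I.Affordable S → I.f S ≤ 96 * M₂)
    (hM₂ : 0 ≤ M₂) : I.optUtility ≤ (8192 * M₁ + 6240 * M₂) * I.reward := by
  classical
  refine csSup_le I.achievable_nonempty ?_
  rintro _ ⟨α, hα, S, hS, rfl⟩
  have hr := I.reward_pos
  have hfS := I.f_nonneg S
  unfold principalUtility
  refine mul_le_mul_of_nonneg_right ?_ hr.le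
  rcases lt_or_ge 1 (∑ i, α i) with hsum | hsum
  · nlinarith
  have hα0 : 0 ≤ ∑ i, α i := Finset.sum_nonneg fun i _ => (hα i).1
  set J := Finset.univ.filter fun i => 1 / 32 < α i with hJ
  set R := S.filter fun j => α (I.agent j) ≤ 1 / 32 with hR
  have hRM := h₂ R (hS.affordable_filter hI hα hsum)
  have hcard : (J.card : ℝ) ≤ 32 := by
    have h3 : ∑ _i ∈ J, (1 / 32 : ℝ) ≤ ∑ i, α i :=
      (Finset.sum_le_sum fun i hi => (Finset.mem_filter.1 hi).2.le).trans
        (Finset.sum_le_sum_of_subset_of_nonneg (Finset.subset_univ _) fun i _ _ => (hα i).1)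
    rw [Finset.sum_const, nsmul_eq_mul] at h3
    linarith
  have hcover : S = R ∪ J.biUnion fun i => S ∩ I.actions i := by
    ext j
    simp only [hR, hJ, Finset.mem_union, Finset.mem_filter, Finset.mem_biUnion, Finset.mem_univ,
      true_and, Finset.mem_inter, mem_actions]
    constructor
    · intro hj
      rcases le_or_gt (α (I.agent j)) (1 / 32) with h | h
      · exact Or.inl ⟨hj, h⟩
      · exact Or.inr ⟨_, h, hj, rfl⟩
    · rintro (h | ⟨_, -, h, -⟩)
      exacts [h.1, h]
  have hf : I.f S ≤ I.f R + ∑ i ∈ J, I.f (S ∩ I.actions i) := by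
    calc I.f S = I.f (R ∪ J.biUnion fun i => S ∩ I.actions i) := by rw [← hcover]
      _ ≤ I.f R + I.f (J.biUnion fun i => S ∩ I.actions i) := hI.f_union_le _ _
      _ ≤ _ := by gcongr; exact hI.f_biUnion_le J _
  have hbig : ∑ i ∈ J, (1 - ∑ i, α i) * I.f (S ∩ I.actions i) ≤
      ∑ _i ∈ J, (256 * M₁ + 192 * M₂) := by
    refine Finset.sum_le_sum fun i hi => ?_
    refine le_trans ?_ (hS.big_agent_le hI hd h₁ hM₁ h₂ hM₂ hα hsum i
      (Finset.mem_filter.1 hi).2)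
    have := I.f_nonneg (S ∩ I.actions i)
    gcongr
    exact Finset.single_le_sum (f := α) (fun i _ => (hα i).1) (Finset.mem_univ i)
  rw [← Finset.mul_sum, Finset.sum_const, nsmul_eq_mul] at hbig
  have h3 : (1 - ∑ i, α i) * I.f S ≤
      (1 - ∑ i, α i) * (I.f R + ∑ i ∈ J, I.f (S ∩ I.actions i)) := by
    gcongr
  have h4 : (1 - ∑ i, α i) * I.f R ≤ 1 * I.f R := by
    have := I.f_nonneg R
    gcongr
    linarith
  -- `32 * 256 = 8192` and `32 * 192 + 96 = 6240`.
  have h5 : (J.card : ℝ) * (256 * M₁ + 192 * M₂) ≤ 32 * (256 * M₁ + 192 * M₂) := by gcongr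
  linarith

/-! ### The contract for a single agent -/

/-- If the actions without cost contribute little, then in every equilibrium that incentivizes only
one agent, at a share halfway between `a` and `1`, the success probability is at least a constant
fraction of the one of the best response to `a`. -/
theorem IsNash.three_mul_response_le (hI : I.IsSubmodular) (hd : IsDemandOracle I.f d) {M : ℝ}
    (hfree : ∀ S : Finset (Fin m), (∀ j ∈ S, I.cost j = 0) → I.f S ≤ M / 8)
    {i : Fin n} {a : ℝ} (ha0 : 0 < a) (ha1 : a < 1)
    (hM : M = (1 - a) * I.f (I.response d i a)) {γ : Fin n → ℝ} (hγi : γ i = (1 + a) / 2)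
    (hγ : ∀ i', i' ≠ i → γ i' = 0) {S : Finset (Fin m)} (hS : I.IsNash γ S) :
    3 * I.f (I.response d i a) ≤ 4 * I.f S := by
  have hr := I.reward_pos
  set D := I.response d i a with hD
  have hDA : D ⊆ I.actions i := response_subset hd ha0.le i
  -- Unpaid agents take only free actions in an equilibrium.
  have hZ := hfree (S \ I.actions i) fun j hj => by
    obtain ⟨hjS, hji⟩ := Finset.mem_sdiff.1 hj
    exact hS.cost_eq_zero hjS (hγ _ fun h => hji (mem_actions.2 h))
  have h1 := hS.deviation i hDA
  have h2 := le_response hd ha0 i (U := S ∩ I.actions i) Finset.inter_subset_right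
  have h3 : I.f S ≤ I.f (S ∩ I.actions i) + I.f (S \ I.actions i) := by
    have := hI.f_union_le (S ∩ I.actions i) (S \ I.actions i)
    rwa [Finset.union_comm, Finset.sdiff_union_inter] at this
  have h4 := I.f_mono D (D ∪ S \ I.actions i) Finset.subset_union_left
  have h5 : γ i * I.f D * I.reward ≤ γ i * I.f (D ∪ S \ I.actions i) * I.reward := by
    rw [hγi]
    gcongr
  have h6 : a * I.f S * I.reward ≤
      a * I.f (S ∩ I.actions i) * I.reward + M / 8 * I.reward := by
    have h7 : a * I.f S ≤ a * I.f (S ∩ I.actions i) + M / 8 := by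
      have := I.f_nonneg (S \ I.actions i)
      nlinarith
    nlinarith
  -- The optimality of `S` at the share `γ i` and of `D` at `a` are added, which cancels the costs.
  -- As `γ i - a = (1 - a) / 2`, the error `M / 8` amounts to a quarter of `f D`.
  have h7 : (γ i - a) * (I.f D - I.f S) * I.reward ≤ M / 8 * I.reward := by
    linarith
  have h8 := le_of_mul_le_mul_right h7 hr
  rw [hγi, hM] at h8
  have h9 : (1 - a) * (3 * I.f D) ≤ (1 - a) * (4 * I.f S) := by linarith
  exact le_of_mul_le_mul_left h9 (by linarith)

end ContractSetting

/-! ### Weakest preconditions of programs -/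

namespace RealRAM

variable {m : ℕ} {f : Finset (Fin m) → ℝ} {d : (Fin m → ℝ) → Finset (Fin m)}

/-- Started in the state `s`, the program `P` halts at a cost of at most `C` in a state with the
property `Q`. -/
def Runs (f : Finset (Fin m) → ℝ) (d : (Fin m → ℝ) → Finset (Fin m)) (P : Program) (C : ℕ)
    (Q : State → Prop) (s : State) : Prop :=
  ∃ t s', Exec f d P s t s' ∧ t.1 + t.2.1 + t.2.2 ≤ C ∧ Q s'

variable {P P' : Program} {C C' : ℕ} {Q Q' : State → Prop} {s : State}

theorem Runs.mono (h : Runs f d P C Q s) (hC : C ≤ C') (hQ : ∀ s', Q s' → Q' s') :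
    Runs f d P C' Q' s := by
  obtain ⟨t, s', hE, ht, hs'⟩ := h
  exact ⟨t, s', hE, ht.trans hC, hQ s' hs'⟩

theorem runs_skip (h : Q s) : Runs f d .skip 1 Q s :=
  ⟨_, _, .skip s, le_rfl, h⟩

theorem runs_assignNat {a : ℕ} {i e : NatExp} (h : Q (s.setNat a (i.eval s) (e.eval s))) :
    Runs f d (.assignNat a i e) (i.size + e.size + 1) Q s :=
  ⟨_, _, .assignNat s a i e, le_rfl, h⟩

theorem runs_assignReal {a : ℕ} {i : NatExp} {e : RealExp}
    (h : Q (s.setReal a (i.eval s) (e.eval s))) :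
    Runs f d (.assignReal a i e) (i.size + e.size + 1) Q s :=
  ⟨_, _, .assignReal s a i e, le_rfl, h⟩

theorem runs_valueQuery {q a : ℕ} {i : NatExp}
    (h : Q (s.setReal a (i.eval s) (f (s.readSet m q)))) :
    Runs f d (.valueQuery q a i) (i.size + m + 2) Q s :=
  ⟨_, _, .valueQuery s q a i, by simp, h⟩

theorem runs_demandQuery {p a : ℕ} (h : Q (s.writeSet a (d (s.readVec m p)))) :
    Runs f d (.demandQuery p a) (m + 2) Q s :=
  ⟨_, _, .demandQuery s p a, by simp, h⟩

/-- The postcondition of `P` is that `P'` runs as required, so correctness proofs walk through a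
program from front to back. -/
theorem runs_seq (h : Runs f d P C (Runs f d P' C' Q) s) :
    Runs f d (.seq P P') (C + C') Q s := by
  obtain ⟨t, s', hE, ht, t', s'', hE', ht', hs⟩ := h
  refine ⟨_, _, .seq hE hE', ?_, hs⟩
  simp only [Prod.fst_add, Prod.snd_add]
  omega

theorem runs_ite {b : Test} (h : b.eval s → Runs f d P C Q s)
    (h' : ¬ b.eval s → Runs f d P' C Q s) : Runs f d (.ite b P P') (b.size + 1 + C) Q s := by
  by_cases hb : b.eval s
  · obtain ⟨t, s', hE, ht, hs⟩ := h hb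
    refine ⟨_, _, .iteTrue hb hE, ?_, hs⟩
    simp only [Prod.fst_add, Prod.snd_add]
    omega
  · obtain ⟨t, s', hE, ht, hs⟩ := h' hb
    refine ⟨_, _, .iteFalse hb hE, ?_, hs⟩
    simp only [Prod.fst_add, Prod.snd_add]
    omega

/-- The natural-number variable `a`, stored in the first entry of array `a`. -/
abbrev natVar (a : ℕ) : NatExp := .get a (.lit 0)

/-- The real variable `a`, stored in the first entry of array `a`. -/
abbrev realVar (a : ℕ) : RealExp := .get a (.lit 0)

/-- Run `P` for each value of the natural-number variable `c` below `e`. -/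
def forLoop (c : ℕ) (e : NatExp) (P : Program) : Program :=
  .seq (.assignNat c (.lit 0) (.lit 0))
    (.loop (.natLe (.add (natVar c) (.lit 1)) e)
      (.seq P (.assignNat c (.lit 0) (.add (natVar c) (.lit 1)))))

/-! ### Reading the memory after a write. -/

@[simp]
theorem nat_setNat (s : State) (a i v b k : ℕ) :
    (s.setNat a i v).nat b k = if b = a ∧ k = i then v else s.nat b k := by
  by_cases h : b = a
  · subst h
    by_cases hk : k = i <;> simp [State.setNat, hk]
  · simp [State.setNat, h]

@[simp]
theorem real_setNat (s : State) (a i v : ℕ) : (s.setNat a i v).real = s.real := rfl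

@[simp]
theorem real_setReal (s : State) (a i : ℕ) (v : ℝ) (b k : ℕ) :
    (s.setReal a i v).real b k = if b = a ∧ k = i then v else s.real b k := by
  by_cases h : b = a
  · subst h
    by_cases hk : k = i <;> simp [State.setReal, hk]
  · simp [State.setReal, h]

@[simp]
theorem nat_setReal (s : State) (a i : ℕ) (v : ℝ) : (s.setReal a i v).nat = s.nat := rfl

@[simp]
theorem real_writeSet (s : State) (a : ℕ) (S : Finset (Fin m)) :
    (s.writeSet a S).real = s.real := rfl

theorem nat_writeSet_of_ne (s : State) {a b : ℕ} (S : Finset (Fin m)) (h : b ≠ a) :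
    (s.writeSet a S).nat b = s.nat b := by
  simp [State.writeSet, h]

theorem nat_writeSet_self (s : State) (a : ℕ) (S : Finset (Fin m)) (j : Fin m) :
    (s.writeSet a S).nat a j = if j ∈ S then 1 else 0 := by
  simp [State.writeSet]

theorem mem_readSet (s : State) (a : ℕ) (j : Fin m) : j ∈ s.readSet m a ↔ s.nat a j ≠ 0 := by
  simp [State.readSet]

/-- A `for`-loop of `N` rounds preserves an invariant that its body preserves. -/
theorem runs_forLoop {c : ℕ} {e : NatExp} {N : ℕ} (Inv : ℕ → State → Prop) (hinit : Inv 0 s)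
    (hcounter : ∀ k s v, Inv k s → Inv k (s.setNat c 0 v))
    (hbound : ∀ k s, Inv k s → e.eval s = N)
    (hbody : ∀ k < N, ∀ s, Inv k s → s.nat c 0 = k →
      Runs f d P C (fun s' => s'.nat c 0 = k ∧ Inv (k + 1) s') s)
    (hQ : ∀ s, Inv N s → Q s) :
    Runs f d (forLoop c e P) (9 + e.size + N * (C + e.size + 12)) Q s := by
  suffices h : ∀ r k s, k + r = N → Inv k s → s.nat c 0 = k →
      Runs f d (.loop (.natLe (.add (natVar c) (.lit 1)) e)
        (.seq P (.assignNat c (.lit 0) (.add (natVar c) (.lit 1)))))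
        (e.size + 6 + r * (C + e.size + 12)) Q s by
    have h1 := runs_seq (f := f) (d := d) (P := .assignNat c (.lit 0) (.lit 0))
      (runs_assignNat (s := s) (h N 0 (s.setNat c 0 0) (zero_add N) (hcounter _ _ _ hinit)
        (by simp)))
    refine h1.mono ?_ fun _ h => h
    simp only [NatExp.size]
    omega
  intro r
  induction r with
  | zero =>
    intro k s hk hs hc
    obtain rfl : k = N := by omega
    refine ⟨_, _, .loopDone ?_, ?_, hQ s hs⟩
    · simp [Test.eval, NatExp.eval, hc, hbound k s hs]
    · simp only [Test.size, NatExp.size]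
      omega
  | succ r ih =>
    intro k s hk hs hc
    obtain ⟨t, s₁, hE, ht, hc₁, hs₁⟩ := hbody k (by omega) s hs hc
    obtain ⟨t', s', hE', ht', hs'⟩ := ih (k + 1) (s₁.setNat c 0 (k + 1)) (by omega)
      (hcounter _ _ _ hs₁) (by simp)
    have hA := Exec.assignNat (f := f) (d := d) s₁ c (.lit 0) (.add (natVar c) (.lit 1))
    simp only [NatExp.eval, hc₁] at hA
    refine ⟨_, s', .loopStep ?_ (.seq hE hA) hE', ?_, hs'⟩
    · simp only [Test.eval, NatExp.eval, hc, hbound k s hs]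
      omega
    · simp only [Test.size, NatExp.size, Prod.fst_add, Prod.snd_add]
      rw [Nat.succ_mul]
      omega

/-- The states `s` and `s'` agree outside the arrays `A` of natural numbers and the arrays `B` of
real numbers. -/
def Agree (A B : List ℕ) (s s' : State) : Prop :=
  (∀ a ∉ A, s'.nat a = s.nat a) ∧ ∀ b ∉ B, s'.real b = s.real b

variable {A A' B B' : List ℕ} {s' s'' : State}

theorem Agree.refl (A B : List ℕ) (s : State) : Agree A B s s := ⟨fun _ _ => rfl, fun _ _ => rfl⟩

theorem Agree.trans (h : Agree A B s s') (h' : Agree A B s' s'') : Agree A B s s'' :=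
  ⟨fun a ha => (h'.1 a ha).trans (h.1 a ha), fun b hb => (h'.2 b hb).trans (h.2 b hb)⟩

theorem Agree.mono (h : Agree A B s s') (hA : A ⊆ A') (hB : B ⊆ B') : Agree A' B' s s' :=
  ⟨fun a ha => h.1 a fun h => ha (hA h), fun b hb => h.2 b fun h => hb (hB h)⟩

theorem Agree.setNat (h : Agree A B s s') {a : ℕ} (ha : a ∈ A) (i v : ℕ) :
    Agree A B s (s'.setNat a i v) := by
  refine ⟨fun b hb => ?_, h.2⟩
  rw [← h.1 b hb]
  ext k
  rw [nat_setNat, if_neg]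
  rintro ⟨rfl, -⟩
  exact hb ha

theorem Agree.setReal (h : Agree A B s s') {b : ℕ} (hb : b ∈ B) (i : ℕ) (v : ℝ) :
    Agree A B s (s'.setReal b i v) := by
  refine ⟨h.1, fun a ha => ?_⟩
  rw [← h.2 a ha]
  ext k
  rw [real_setReal, if_neg]
  rintro ⟨rfl, -⟩
  exact ha hb

theorem Agree.writeSet (h : Agree A B s s') {a : ℕ} (ha : a ∈ A) (S : Finset (Fin m)) :
    Agree A B s (s'.writeSet a S) := by
  refine ⟨fun b hb => ?_, h.2⟩
  rw [← h.1 b hb, nat_writeSet_of_ne]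
  rintro rfl
  exact hb ha

theorem Agree.readSet (h : Agree A B s s') {a : ℕ} (ha : a ∉ A) :
    s'.readSet m a = s.readSet m a := by
  simp only [State.readSet, h.1 a ha]

theorem readSet_setNat_of_ne {a b : ℕ} (h : b ≠ a) (s : State) (i v : ℕ) :
    (s.setNat a i v).readSet m b = s.readSet m b := by
  ext j
  simp [mem_readSet, h]

/-- The memory holds the contract setting `I`. -/
structure Holds {n : ℕ} (I : ContractSetting n m) (s : State) : Prop where
  agents : s.nat 0 0 = n
  size : s.nat 0 1 = m
  agent : ∀ j : Fin m, s.nat 1 j = I.agent j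
  cost : ∀ j : Fin m, s.real 0 j = I.cost j
  reward : s.real 1 0 = I.reward

theorem holds_input {n : ℕ} (I : ContractSetting n m) : Holds I (input I) := by
  constructor <;> simp [input]

theorem Holds.agree {n : ℕ} {I : ContractSetting n m} (hs : Holds I s) (h : Agree A B s s')
    (hA : 0 ∉ A ∧ 1 ∉ A) (hB : 0 ∉ B ∧ 1 ∉ B) : Holds I s' := by
  constructor
  · rw [h.1 0 hA.1, hs.agents]
  · rw [h.1 0 hA.1, hs.size]
  · intro j
    rw [h.1 1 hA.2, hs.agent]
  · intro j
    rw [h.2 0 hB.1, hs.cost]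
  · rw [h.2 1 hB.2, hs.reward]

/-! ### Subroutines -/

/-- The number of agents. -/
abbrev agentsExp : NatExp := .get 0 (.lit 0)

/-- The number of actions. -/
abbrev actionsExp : NatExp := .get 0 (.lit 1)

/-- Copy the set of actions in array `a` to array `b`. -/
def copySet (a b : ℕ) : Program :=
  forLoop 11 actionsExp (.assignNat b (natVar 11) (.get a (natVar 11)))

theorem runs_copySet {n : ℕ} {I : ContractSetting n m} (hs : Holds I s) {a b : ℕ}
    (hab : a ≠ b) (ha : a ≠ 11) (hb : b ≠ 11) (hb0 : b ≠ 0) (hb1 : b ≠ 1)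
    (hQ : ∀ s', Agree [11, b] [] s s' → s'.readSet m b = s.readSet m a → Q s') :
    Runs f d (copySet a b) (11 + m * 20) Q s := by
  refine (runs_forLoop (f := f) (d := d) (N := m) (C := 6)
    (fun k s' => Agree [11, b] [] s s' ∧ ∀ j : Fin m, (j : ℕ) < k → s'.nat b j = s.nat a j)
    ⟨.refl _ _ _, fun j hj => absurd hj (Nat.not_lt_zero _)⟩ ?_ ?_ ?_ ?_).mono ?_
    fun _ h => h
  · rintro k s' v ⟨h1, h2⟩
    exact ⟨h1.setNat (by simp) _ _, fun j hj => by simp [h2 j hj, hb]⟩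
  · rintro k s' ⟨h1, -⟩
    exact (hs.agree h1 (by simp; omega) (by simp)).size
  · rintro k hk s' ⟨h1, h2⟩ hc
    refine (runs_assignNat ?_).mono le_rfl fun _ h => h
    simp only [NatExp.eval, hc]
    refine ⟨by simp [hc, hb.symm], h1.setNat (by simp) _ _, fun j hj => ?_⟩
    rw [nat_setNat, h1.1 a (by simp; omega)]
    split_ifs with h
    · rw [h.2]
    · exact h2 j (by simp at h; omega)
  · rintro s' ⟨h1, h2⟩
    refine hQ s' h1 ?_
    ext j
    simp [mem_readSet, h2 j j.2]
  · simp [NatExp.size]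

/-- Extend the set in array `2` by a demand query for the agent in variable `10`, whose costs are
scaled by the real variable `10`.  The extended set is written to array `3`, its value to the real
variable `11` and the sum of its prices to the real variable `12`. -/
def extendSet : Program :=
  .seq (forLoop 11 actionsExp
    (.ite (.natLe (.get 2 (natVar 11)) (.lit 0))
      (.ite (.conj (.natLe (.get 1 (natVar 11)) (natVar 10))
          (.natLe (natVar 10) (.get 1 (natVar 11))))
        (.assignReal 3 (natVar 11) (.mul (.get 0 (natVar 11)) (realVar 10)))
        (.assignReal 3 (natVar 11) (.ofNat (.lit 2))))
      (.assignReal 3 (natVar 11) (.ofNat (.lit 0))))) <|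
  .seq (.demandQuery 3 3) <|
  .seq (.assignReal 12 (.lit 0) (.ofNat (.lit 0))) <|
  .seq (forLoop 11 actionsExp
    (.seq (.ite (.natLe (.get 2 (natVar 11)) (.lit 0)) .skip
        (.assignNat 3 (natVar 11) (.lit 1)))
      (.ite (.natLe (.get 3 (natVar 11)) (.lit 0)) .skip
        (.assignReal 12 (.lit 0) (.add (realVar 12) (.get 3 (natVar 11))))))) <|
  .valueQuery 3 11 (.lit 0)

/-- The increment of the partial sums that the second loop of `extendSet` accumulates. -/
theorem sum_filter_lt_succ (D : Finset (Fin m)) (g : Fin m → ℝ) (j : Fin m) :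
    ∑ x ∈ D.filter (fun x : Fin m => (x : ℕ) < j + 1), g x =
      ∑ x ∈ D.filter (fun x : Fin m => (x : ℕ) < j), g x + if j ∈ D then g j else 0 := by
  have h : (D.filter fun x : Fin m => (x : ℕ) < j + 1) =
      (D.filter fun x : Fin m => (x : ℕ) < j) ∪ if j ∈ D then {j} else ∅ := by
    ext x
    simp only [Finset.mem_filter, Finset.mem_union, Nat.lt_succ_iff_lt_or_eq]
    split_ifs with hj
    · simp only [Finset.mem_singleton, Fin.ext_iff]
      constructor
      · tauto
      · rintro (h | h)
        · tauto
        · rw [← Fin.ext_iff] at h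
          subst h
          exact ⟨hj, Or.inr rfl⟩
    · simp only [Finset.notMem_empty, or_false, and_congr_right_iff, or_iff_left_iff_imp]
      intro hx h
      rw [← Fin.ext_iff] at h
      exact absurd (h ▸ hx) hj
  rw [h, Finset.sum_union]
  · split_ifs <;> simp
  · split_ifs <;> simp

theorem runs_extendSet {n : ℕ} {I : ContractSetting n m} (hs : Holds I s) {T : Finset (Fin m)}
    {i : ℕ} {x : ℝ} (hT : s.readSet m 2 = T) (hi : s.nat 10 0 = i) (hx : s.real 10 0 = x)
    (hQ : ∀ s', Agree [3, 11] [3, 11, 12] s s' → s'.readSet m 3 = I.demandSet d T i x →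
      s'.real 11 0 = I.f (I.demandSet d T i x) →
      s'.real 12 0 = ∑ j ∈ I.demandSet d T i x, I.demandPrice T i x j → Q s') :
    Runs I.f d extendSet (100 + 100 * m) Q s := by
  set p := I.demandPrice T i x with hp
  have hTj : ∀ j : Fin m, j ∈ T ↔ s.nat 2 j ≠ 0 := fun j => by rw [← hT, mem_readSet]
  refine (runs_seq (C := 11 + m * 44) (C' := 89 + m * 56) ?_).mono (by omega) fun _ h => h
  refine (runs_forLoop (N := m) (C := 30)
    (fun k s' => Agree [11] [3] s s' ∧ ∀ j : Fin m, (j : ℕ) < k → s'.real 3 j = p j)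
    ⟨.refl _ _ _, fun j hj => absurd hj (Nat.not_lt_zero _)⟩ ?_ ?_ ?_ ?_).mono ?_
    fun _ h => h
  · rintro k s' v ⟨h1, h2⟩
    exact ⟨h1.setNat (by simp) _ _, h2⟩
  · rintro k s' ⟨h1, -⟩
    exact (hs.agree h1 (by simp) (by simp)).size
  · rintro k hk s₁ ⟨h1, h2⟩ hc
    have hs₁ := hs.agree h1 (by simp) (by simp)
    have key : ∀ v, v = p ⟨k, hk⟩ → (s₁.setReal 3 k v).nat 11 0 = k ∧
        Agree [11] [3] s (s₁.setReal 3 k v) ∧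
        ∀ j : Fin m, (j : ℕ) < k + 1 → (s₁.setReal 3 k v).real 3 j = p j := by
      rintro v rfl
      refine ⟨by simp [hc], h1.setReal (by simp) _ _, fun j hj => ?_⟩
      rw [real_setReal]
      split_ifs with h
      · congr 1
        exact Fin.ext h.2.symm
      · exact h2 j (by simp at h; omega)
    have h2k : s₁.nat 2 k = s.nat 2 k := by rw [h1.1 2 (by simp)]
    have h10 : s₁.nat 10 0 = i := by rw [h1.1 10 (by simp), hi]
    have hr10 : s₁.real 10 0 = x := by rw [h1.2 10 (by simp), hx]
    have hag := hs₁.agent ⟨k, hk⟩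
    have hcost := hs₁.cost ⟨k, hk⟩
    have hTk := hTj ⟨k, hk⟩
    simp only at hag hcost hTk
    refine (runs_ite (C := 23) (fun hb => ?_) fun hb => ?_).mono ?_ fun _ h => h
    · simp only [Test.eval, NatExp.eval, hc, h2k, nonpos_iff_eq_zero] at hb
      refine (runs_ite (C := 9) (fun hb' => ?_) fun hb' => ?_).mono ?_ fun _ h => h
      · refine (runs_assignReal ?_).mono ?_ fun _ h => h
        · simp only [NatExp.eval, RealExp.eval, hc, hcost, hr10]
          refine key _ ?_
          simp only [Test.eval, NatExp.eval, hc, hag, h10] at hb'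
          simp [hp, ContractSetting.demandPrice, hTk, hb, le_antisymm hb'.1 hb'.2]
        · simp [NatExp.size, RealExp.size]
      · refine (runs_assignReal ?_).mono ?_ fun _ h => h
        · simp only [NatExp.eval, RealExp.eval, hc]
          refine key _ ?_
          simp only [Test.eval, NatExp.eval, hc, hag, h10] at hb'
          have : ¬ ((I.agent ⟨k, hk⟩ : ℕ) = i) := by omega
          simp [hp, ContractSetting.demandPrice, hTk, hb, this]
        · simp [NatExp.size, RealExp.size]
      · simp [Test.size, NatExp.size]
    · simp only [Test.eval, NatExp.eval, hc, h2k, nonpos_iff_eq_zero] at hb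
      refine (runs_assignReal ?_).mono ?_ fun _ h => h
      · simp only [NatExp.eval, RealExp.eval, hc]
        refine key _ ?_
        simp [hp, ContractSetting.demandPrice, hTk, hb]
      · simp [NatExp.size, RealExp.size]
    · simp [Test.size, NatExp.size]
  rotate_left
  · simp [NatExp.size]
  rintro s₁ ⟨h1, h2⟩
  have hvec : s₁.readVec m 3 = p := funext fun j => h2 j j.2
  set D := I.demandSet d T i x with hD
  refine (runs_seq (C := m + 2) (C' := 87 + m * 55) ?_).mono (by omega) fun _ h => h
  refine runs_demandQuery ?_
  refine (runs_seq (C := 4) (C' := 83 + m * 55) ?_).mono (by omega) fun _ h => h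
  refine (runs_assignReal ?_).mono (by simp [NatExp.size, RealExp.size]) fun _ h => h
  rw [hvec]
  simp only [NatExp.eval, RealExp.eval, Nat.cast_zero]
  set s₂ := (s₁.writeSet 3 (d p)).setReal 12 0 0 with hs₂
  have h12 : Agree [3, 11] [3, 11, 12] s s₂ :=
    ((h1.mono (by simp) (by simp)).writeSet (by simp) _).setReal (by simp) _ _
  refine (runs_seq (C := 11 + m * 40) (C' := m + 3) ?_).mono (by omega) fun _ h => h
  -- The answer of the oracle is turned into `T ∪ d p` in place, while its prices are summed: the
  -- entries below `k` are done.
  refine (runs_forLoop (N := m) (C := 26)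
    (fun k s' => Agree [3, 11] [3, 11, 12] s s' ∧ (∀ j : Fin m, s'.real 3 j = p j) ∧
      (∀ j : Fin m, s'.nat 3 j ≠ 0 ↔ if (j : ℕ) < k then j ∈ D else j ∈ d p) ∧
      s'.real 12 0 = ∑ j ∈ D.filter (fun j : Fin m => (j : ℕ) < k), p j)
    ⟨h12, ?_, ?_, ?_⟩ ?_ ?_ ?_ ?_).mono ?_ fun _ h => h
  · intro j
    simp [hs₂, h2 j j.2]
  · intro j
    simp [hs₂, nat_writeSet_self]
  · simp [hs₂]
  · rintro k s' v ⟨h3, h4, h5, h6⟩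
    exact ⟨h3.setNat (by simp) _ _, h4, fun j => by simpa using h5 j, h6⟩
  · rintro k s' ⟨h3, -⟩
    exact (hs.agree h3 (by simp) (by simp)).size
  · rintro k hk s₃ ⟨h3, h4, h5, h6⟩ hc
    have h2k : s₃.nat 2 k = s.nat 2 k := by rw [h3.1 2 (by simp)]
    have hTk := hTj ⟨k, hk⟩
    have h5k := h5 ⟨k, hk⟩
    have h4k := h4 ⟨k, hk⟩
    simp only [lt_irrefl, if_false] at h5k
    simp only at hTk h4k
    refine (runs_seq (C := 12) (C' := 14) ?_).mono (by omega) fun _ h => h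
    -- Both branches of the first test lead to such a state, so the second test is treated only
    -- once.
    suffices hmid : ∀ s₄ : State, Agree [3, 11] [3, 11, 12] s s₄ → s₄.real = s₃.real →
        s₄.nat 11 0 = k →
        (∀ j : Fin m, s₄.nat 3 j ≠ 0 ↔ if (j : ℕ) < k + 1 then j ∈ D else j ∈ d p) →
        Runs I.f d (.ite (.natLe (.get 3 (natVar 11)) (.lit 0)) .skip
          (.assignReal 12 (.lit 0) (.add (realVar 12) (.get 3 (natVar 11))))) 14
          (fun s' => s'.nat 11 0 = k ∧ Agree [3, 11] [3, 11, 12] s s' ∧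
            (∀ j : Fin m, s'.real 3 j = p j) ∧
            (∀ j : Fin m, s'.nat 3 j ≠ 0 ↔ if (j : ℕ) < k + 1 then j ∈ D else j ∈ d p) ∧
            s'.real 12 0 = ∑ j ∈ D.filter (fun j : Fin m => (j : ℕ) < k + 1), p j) s₄ by
      have hlt : ∀ j : Fin m, (j : ℕ) ≠ k → (((j : ℕ) < k + 1) ↔ (j : ℕ) < k) := fun j hj => by
        omega
      have hDk : (⟨k, hk⟩ : Fin m) ∈ D ↔ (⟨k, hk⟩ : Fin m) ∈ T ∨ (⟨k, hk⟩ : Fin m) ∈ d p :=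
        Finset.mem_union
      refine (runs_ite (C := 5) (fun hb => ?_) fun hb => ?_).mono ?_ fun _ h => h
      · simp only [Test.eval, NatExp.eval, hc, h2k, nonpos_iff_eq_zero] at hb
        refine (runs_skip (hmid s₃ h3 rfl hc fun j => ?_)).mono (by norm_num) fun _ h => h
        rw [h5 j]
        by_cases hj : (j : ℕ) = k
        · obtain rfl : j = ⟨k, hk⟩ := Fin.ext hj
          simp [hDk, hTk, hb]
        · simp [hlt j hj]
      · simp only [Test.eval, NatExp.eval, hc, h2k, nonpos_iff_eq_zero] at hb
        refine (runs_assignNat (hmid _ (h3.setNat (by simp) _ _) rfl (by simp [hc])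
          fun j => ?_)).mono (by simp [NatExp.size]) fun _ h => h
        simp only [NatExp.eval, hc, nat_setNat, true_and]
        by_cases hj : (j : ℕ) = k
        · obtain rfl : j = ⟨k, hk⟩ := Fin.ext hj
          simp [hDk, hTk, hb]
        · simp [hlt j hj, hj, ← h5 j]
      · simp [Test.size, NatExp.size]
    intro s₄ h7 h8 hc₄ h9
    have h9k := h9 ⟨k, hk⟩
    simp only [Nat.lt_succ_self, if_true] at h9k
    have hsum := sum_filter_lt_succ D p ⟨k, hk⟩
    simp only at hsum
    rw [hsum, ← h6]
    refine (runs_ite (C := 8) (fun hb => ?_) fun hb => ?_).mono ?_ fun _ h => h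
    · simp only [Test.eval, NatExp.eval, hc₄, nonpos_iff_eq_zero] at hb
      refine (runs_skip ?_).mono (by norm_num) fun _ h => h
      have : (⟨k, hk⟩ : Fin m) ∉ D := fun h => h9k.2 h hb
      exact ⟨hc₄, h7, by rwa [h8], h9, by simp [this, h8]⟩
    · simp only [Test.eval, NatExp.eval, hc₄, nonpos_iff_eq_zero] at hb
      refine (runs_assignReal ?_).mono (by simp [NatExp.size, RealExp.size]) fun _ h => h
      have : (⟨k, hk⟩ : Fin m) ∈ D := h9k.1 hb
      refine ⟨hc₄, h7.setReal (by simp) _ _, fun j => by simp [h8, h4 j], h9, ?_⟩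
      simp [NatExp.eval, RealExp.eval, hc₄, this, h8, h4k]
    · simp [Test.size, NatExp.size]
  · rintro s₃ ⟨h3, -, h5, h6⟩
    have hset : s₃.readSet m 3 = D := by
      ext j
      rw [mem_readSet, h5 j, if_pos j.2]
    refine (runs_valueQuery ?_).mono (by simp [NatExp.size]; omega) fun _ h => h
    rw [hset]
    refine hQ _ (h3.setReal (by simp) _ _) ?_ ?_ ?_
    · exact hset
    · simp [NatExp.eval]
    · simp [NatExp.eval, h6]
  · simp [NatExp.size]

end RealRAM

namespace RealRAM

variable {n m : ℕ} {I : ContractSetting n m} {d : (Fin m → ℝ) → Finset (Fin m)}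
  {s : State} {Q : State → Prop}

/-! ### The search for a contract with a single incentivized agent -/

/-- The real variables `15` and `16` and the variable `18` hold the value, the share and the agent
of a contract that incentivizes a single agent, or the real variable `15` is `0`. -/
def Found (I : ContractSetting n m) (d : (Fin m → ℝ) → Finset (Fin m)) (s : State) : Prop :=
  0 ≤ s.real 15 0 ∧ (s.real 15 0 = 0 ∨ ∃ i : Fin n, s.nat 18 0 = i ∧ 0 < s.real 16 0 ∧
    s.real 16 0 < 1 ∧ s.real 15 0 = (1 - s.real 16 0) * I.f (I.response d i (s.real 16 0)))

theorem Found.agree {A B : List ℕ} {s' : State} (hs : Found I d s) (h : Agree A B s s')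
    (hA : 18 ∉ A) (hB : 15 ∉ B ∧ 16 ∉ B) : Found I d s' := by
  unfold Found
  rwa [h.1 18 hA, h.2 15 hB.1, h.2 16 hB.2]

/-- `M` bounds the value of a point of the grid of shares. -/
def PointBound (I : ContractSetting n m) (d : (Fin m → ℝ) → Finset (Fin m)) (i : ℕ) (j : Fin m)
    (k : ℕ) (M : ℝ) : Prop :=
  I.gridShare d i j k < 1 →
    I.gridShare d i j k * I.f (I.response d i (1 - I.gridShare d i j k)) ≤ M

/-- Evaluate a point of the grid of shares, and move on to the next one. -/
def tryShare : Program :=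
  .seq (.ite (.neg (.realLe (.ofNat (.lit 1)) (realVar 14)))
    (.seq (.assignReal 10 (.lit 0)
      (.div (.ofNat (.lit 1)) (.mul (.sub (.ofNat (.lit 1)) (realVar 14)) (realVar 1)))) <|
    .seq extendSet <|
    .ite (.realLe (.mul (realVar 14) (realVar 11)) (realVar 15)) .skip <|
    .seq (.assignReal 15 (.lit 0) (.mul (realVar 14) (realVar 11))) <|
    .seq (.assignReal 16 (.lit 0) (.sub (.ofNat (.lit 1)) (realVar 14))) <|
    .assignNat 18 (.lit 0) (natVar 10))
    .skip) <|
  .assignReal 14 (.lit 0) (.div (realVar 14) (.ofNat (.lit 2)))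

theorem runs_tryShare (hd : IsDemandOracle I.f d) (hs : Holds I s)
    (hT : s.readSet m 2 = (∅ : Finset (Fin m))) {i : Fin n} {j : Fin m} {k : ℕ}
    (hi : s.nat 10 0 = i) (hy : s.real 14 0 = I.gridShare d i j k) (hF : Found I d s)
    (hQ : ∀ s', Agree [3, 11, 18] [3, 10, 11, 12, 14, 15, 16] s s' →
      s'.real 14 0 = I.gridShare d i j (k + 1) → Found I d s' →
      s.real 15 0 ≤ s'.real 15 0 → PointBound I d i j k (s'.real 15 0) → Q s') :
    Runs I.f d tryShare (160 + 100 * m) Q s := by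
  have hr := I.reward_pos
  set y := I.gridShare d i j k with hydef
  have hynext : y / 2 = I.gridShare d i j (k + 1) := by
    simp only [hydef, ContractSetting.gridShare, pow_succ]
    field_simp
  have hy0 : 0 ≤ y := ContractSetting.gridShare_nonneg hd i j k
  suffices hmid : ∀ s₁, Agree [3, 11, 18] [3, 10, 11, 12, 15, 16] s s₁ → Found I d s₁ →
      s.real 15 0 ≤ s₁.real 15 0 → PointBound I d i j k (s₁.real 15 0) →
      Runs I.f d (.assignReal 14 (.lit 0) (.div (realVar 14) (.ofNat (.lit 2)))) 7 Q s₁ by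
    refine (runs_seq (C := 153 + 100 * m) (C' := 7) ?_).mono (by omega) fun _ h => h
    refine (runs_ite (C := 146 + 100 * m) (fun hb => ?_) fun hb => ?_).mono
      (by simp [Test.size, NatExp.size, RealExp.size]; omega) fun _ h => h
    · simp only [Test.eval, RealExp.eval, NatExp.eval, hy, Nat.cast_one, not_le] at hb
      refine (runs_seq (C := 13) (C' := 130 + 100 * m) (runs_assignReal ?_)).mono (by omega)
        fun _ h => h
      refine (runs_seq (C := 100 + 100 * m) (C' := 30) ?_).mono (by omega) fun _ h => h
      simp only [RealExp.eval, NatExp.eval, hy, hs.reward, Nat.cast_one]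
      have hA : Agree [3, 11, 18] [3, 10, 11, 12, 15, 16] s
          (s.setReal 10 0 (1 / ((1 - y) * I.reward))) :=
        (Agree.refl _ _ _).setReal (by simp) _ _
      refine runs_extendSet (T := ∅) (i := i) (x := 1 / ((1 - y) * I.reward))
        (hs.agree hA (by simp) (by simp)) hT (by simp [hi]) (by simp) ?_
      intro s₁ h1 h2 h3 h4
      have hA₁ := hA.trans (h1.mono (by simp) (by simp))
      have hy₁ : s₁.real 14 0 = y := by rw [hA₁.2 14 (by simp), hy]
      have hM₁ : s₁.real 15 0 = s.real 15 0 := by rw [h1.2 15 (by simp)]; simp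
      have hi₁ : s₁.nat 10 0 = i := by rw [hA₁.1 10 (by simp), hi]
      have hF₁ : Found I d s₁ := by
        have hF₀ : Found I d (s.setReal 10 0 (1 / ((1 - y) * I.reward))) := by
          simpa [Found] using hF
        exact hF₀.agree h1 (by simp) (by simp)
      change s₁.real 11 0 = I.f (I.response d i (1 - y)) at h3
      refine (runs_ite (C := 21) (fun hb₁ => ?_) fun hb₁ => ?_).mono
        (by simp [Test.size, NatExp.size, RealExp.size]) fun _ h => h
      · simp only [Test.eval, RealExp.eval, NatExp.eval, hy₁, h3, hM₁] at hb₁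
        exact (runs_skip (hmid s₁ hA₁ hF₁ hM₁.ge fun _ => by rwa [hM₁])).mono (by norm_num)
          fun _ h => h
      · simp only [Test.eval, RealExp.eval, NatExp.eval, hy₁, h3, hM₁, not_le] at hb₁
        refine (runs_seq (C := 7) (C' := 14) (runs_assignReal ?_)).mono (by omega) fun _ h => h
        refine (runs_seq (C := 7) (C' := 7) (runs_assignReal ?_)).mono (by omega) fun _ h => h
        refine (runs_assignNat ?_).mono (by simp [NatExp.size]) fun _ h => h
        simp only [RealExp.eval, NatExp.eval, hy₁, h3, Nat.cast_one, nat_setReal, hi₁,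
          real_setReal]
        norm_num only [false_and, if_false, hy₁]
        -- The recorded value is nonnegative, so only a positive grid share can beat it, and the
        -- share `1 - y` that is recorded lies below 1. If `f {j} = 0`, division by zero makes the
        -- grid share `0`, which is never recorded.
        have hy1 : y ≠ 0 := by
          intro h
          rw [h, zero_mul] at hb₁
          exact absurd hF.1 (not_le.2 hb₁)
        refine hmid _ (((hA₁.setReal (by simp) _ _).setReal (by simp) _ _).setNat (by simp) _ _)
          ⟨?_, Or.inr ⟨i, ?_, ?_, ?_, ?_⟩⟩ ?_ fun _ => ?_
        · simp only [real_setNat, real_setReal]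
          norm_num
          exact mul_nonneg hy0 (I.f_nonneg _)
        · simp
        · simpa using hb
        · simpa using lt_of_le_of_ne hy0 hy1.symm
        · simp
        · simpa using hb₁.le
        · simp [hydef]
    · simp only [Test.eval, RealExp.eval, NatExp.eval, hy, Nat.cast_one, not_not] at hb
      refine (runs_skip (hmid s (.refl _ _ _) hF le_rfl fun h => ?_)).mono (by omega)
        fun _ h => h
      exact absurd h (not_lt.2 hb)
  intro s₁ h1 h2 h3 h4
  refine (runs_assignReal ?_).mono (by simp [NatExp.size, RealExp.size]) fun _ h => h
  simp only [RealExp.eval, NatExp.eval, h1.2 14 (by simp), hy]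
  refine hQ _ ((h1.mono (by simp) (by simp)).setReal (by simp) _ _) (by simp [← hynext]) ?_ ?_ ?_
  · simpa [Found] using h2
  · simpa using h3
  · simpa using h4

/-- Evaluate the grid points of the agent in variable `10` and the action in variable `14`. -/
def tryAction : Program :=
  .seq (.assignNat 19 (natVar 14) (.lit 1)) <|
  .seq (.valueQuery 19 14 (.lit 0)) <|
  .seq (.assignReal 14 (.lit 0) (.div (realVar 13) (realVar 14))) <|
  .seq (.assignNat 19 (natVar 14) (.lit 0)) <|
  forLoop 12 (.add (.add (.add actionsExp actionsExp) actionsExp) (.lit 4)) tryShare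

theorem runs_tryAction (hd : IsDemandOracle I.f d) (hs : Holds I s)
    (hT : s.readSet m 2 = (∅ : Finset (Fin m))) (h19 : ∀ k, s.nat 19 k = 0)
    {i : Fin n} {j : Fin m} (hi : s.nat 10 0 = i) (hj : s.nat 14 0 = j)
    (hW : s.real 13 0 = I.welfare d i) (hF : Found I d s)
    (hQ : ∀ s', Agree [3, 11, 12, 18, 19] [3, 10, 11, 12, 14, 15, 16] s s' →
      (∀ k, s'.nat 19 k = 0) → Found I d s' → s.real 15 0 ≤ s'.real 15 0 →
      (∀ k < 3 * m + 4, PointBound I d i j k (s'.real 15 0)) → Q s') :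
    Runs I.f d tryAction (40 + m + (3 * m + 4) * (182 + 100 * m)) Q s := by
  refine (runs_seq (C := 4) (C' := 36 + m + (3 * m + 4) * (182 + 100 * m))
    (runs_assignNat ?_)).mono (by omega) fun _ h => h
  simp only [NatExp.eval, hj]
  set s₁ := s.setNat 19 j 1 with hs₁
  have h1 : Agree [3, 11, 12, 18, 19] [3, 10, 11, 12, 14, 15, 16] s s₁ :=
    (Agree.refl _ _ _).setNat (by simp) _ _
  -- Array `19` is kept at zero between calls, so a single write makes it encode a singleton.
  have hset : s₁.readSet m 19 = {j} := by
    ext x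
    simp [mem_readSet, hs₁, h19, Fin.ext_iff]
  refine (runs_seq (C := m + 3) (C' := 33 + (3 * m + 4) * (182 + 100 * m)) ?_).mono (by omega)
    fun _ h => h
  refine (runs_valueQuery ?_).mono (by simp [NatExp.size]; omega) fun _ h => h
  rw [hset]
  refine (runs_seq (C := 7) (C' := 26 + (3 * m + 4) * (182 + 100 * m))
    (runs_assignReal ?_)).mono (by omega) fun _ h => h
  simp only [NatExp.eval, RealExp.eval, real_setReal]
  norm_num only [false_and, if_false, true_and, if_true]
  have hW₁ : s₁.real 13 0 = I.welfare d i := by simpa [hs₁] using hW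
  rw [hW₁]
  set s₂ := (s₁.setReal 14 0 (I.f {j})).setReal 14 0 (I.welfare d i / I.f {j}) with hs₂
  have h2 : Agree [3, 11, 12, 18, 19] [3, 10, 11, 12, 14, 15, 16] s s₂ :=
    (h1.setReal (by simp) _ _).setReal (by simp) _ _
  refine (runs_seq (C := 4) (C' := 22 + (3 * m + 4) * (182 + 100 * m))
    (runs_assignNat ?_)).mono (by omega) fun _ h => h
  have hj₂ : s₂.nat 14 0 = j := by rw [h2.1 14 (by simp), hj]
  simp only [NatExp.eval, hj₂]
  set s₃ := s₂.setNat 19 j 0 with hs₃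
  have h3 : Agree [3, 11, 12, 18, 19] [3, 10, 11, 12, 14, 15, 16] s s₃ :=
    h2.setNat (by simp) _ _
  -- The recorded value never decreases, so the bounds at earlier grid points persist.
  refine (runs_forLoop (N := 3 * m + 4) (C := 160 + 100 * m)
    (fun k s' => Agree [3, 11, 12, 18, 19] [3, 10, 11, 12, 14, 15, 16] s s' ∧
      (∀ k, s'.nat 19 k = 0) ∧ Found I d s' ∧ s.real 15 0 ≤ s'.real 15 0 ∧
      s'.real 14 0 = I.gridShare d i j k ∧
      ∀ k' < k, PointBound I d i j k' (s'.real 15 0)) ⟨h3, ?_, ?_, ?_, ?_, ?_⟩ ?_ ?_ ?_ ?_).mono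
    ?_ fun _ h => h
  · intro k
    simp [hs₃, hs₂, hs₁, h19]
  · simpa [Found, hs₃, hs₂, hs₁] using hF
  · simp [hs₃, hs₂, hs₁]
  · simp [hs₃, hs₂, ContractSetting.gridShare]
  · exact fun k hk => absurd hk (Nat.not_lt_zero _)
  · rintro k s' v ⟨h4, h5, h6, h7, h8, h9⟩
    exact ⟨h4.setNat (by simp) _ _, by simpa using h5, by simpa [Found] using h6, h7, h8, h9⟩
  · rintro k s' ⟨h4, -⟩
    simp only [NatExp.eval, (hs.agree h4 (by simp) (by simp)).size]
    omega
  · rintro k hk s' ⟨h4, h5, h6, h7, h8, h9⟩ hc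
    refine runs_tryShare hd (hs.agree h4 (by simp) (by simp))
      ((h4.readSet (by simp)).trans hT) (by rw [h4.1 10 (by simp), hi]) h8 h6 ?_
    intro s'' h10 h11 h12 h13 h14
    refine ⟨by rw [h10.1 12 (by simp), hc], h4.trans (h10.mono (by simp) (by simp)),
      fun k => by rw [h10.1 19 (by simp), h5], h12, h7.trans h13, h11, fun k' hk' hlt => ?_⟩
    rcases Nat.lt_succ_iff_lt_or_eq.1 hk' with h | rfl
    · exact (h9 k' h hlt).trans h13
    · exact h14 hlt
  · rintro s' ⟨h4, h5, h6, h7, -, h9⟩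
    exact hQ s' h4 h5 h6 h7 h9
  · simp [NatExp.size]
    ring_nf
    omega

/-- Search the grids of shares of all agents. -/
def searchSingle : Program :=
  forLoop 10 agentsExp <|
  .seq (.assignReal 10 (.lit 0) (.div (.ofNat (.lit 1)) (realVar 1))) <|
  .seq extendSet <|
  .seq (.assignReal 13 (.lit 0) (.sub (realVar 11) (realVar 12))) <|
  forLoop 14 actionsExp tryAction

/-- A bound on the cost of the search for one agent. -/
def searchAgentCost (m : ℕ) : ℕ :=
  130 + 100 * m + m * (54 + m + (3 * m + 4) * (182 + 100 * m))

theorem runs_searchSingle (hd : IsDemandOracle I.f d) (hs : Holds I s)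
    (hT : s.readSet m 2 = (∅ : Finset (Fin m))) (h19 : ∀ k, s.nat 19 k = 0)
    (hM : s.real 15 0 = 0)
    (hQ : ∀ s', Agree [3, 10, 11, 12, 14, 18, 19] [3, 10, 11, 12, 13, 14, 15, 16] s s' →
      Found I d s' → I.GridBound d (s'.real 15 0) → Q s') :
    Runs I.f d searchSingle (11 + n * (searchAgentCost m + 14)) Q s := by
  refine (runs_forLoop (N := n) (C := searchAgentCost m)
    (fun i s' => Agree [3, 10, 11, 12, 14, 18, 19] [3, 10, 11, 12, 13, 14, 15, 16] s s' ∧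
      (∀ k, s'.nat 19 k = 0) ∧ Found I d s' ∧
      ∀ i' < i, ∀ (j : Fin m), ∀ k < 3 * m + 4, PointBound I d i' j k (s'.real 15 0))
    ⟨.refl _ _ _, h19, ⟨hM.ge, Or.inl hM⟩, fun i hi => absurd hi (Nat.not_lt_zero _)⟩
    ?_ ?_ ?_ ?_).mono ?_ fun _ h => h
  · rintro i s' v ⟨h1, h2, h3, h4⟩
    exact ⟨h1.setNat (by simp) _ _, by simpa using h2, by simpa [Found] using h3, h4⟩
  · rintro i s' ⟨h1, -⟩
    exact (hs.agree h1 (by simp) (by simp)).agents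
  · rintro i hi s₁ ⟨h1, h2, h3, h4⟩ hc
    have hs₁ := hs.agree h1 (by simp) (by simp)
    refine (runs_seq (C := 7)
      (C' := 120 + 100 * m + m * (54 + m + (3 * m + 4) * (182 + 100 * m)))
      (runs_assignReal ?_)).mono (by simp [searchAgentCost]; omega) fun _ h => h
    simp only [NatExp.eval, RealExp.eval, Nat.cast_one, hs₁.reward]
    set s₂ := s₁.setReal 10 0 (1 / I.reward) with hs₂
    have h12 : Agree [3, 11] [3, 10, 11, 12] s₁ s₂ := (Agree.refl _ _ _).setReal (by simp) _ _
    refine (runs_seq (C := 100 + 100 * m)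
      (C' := 20 + m * (54 + m + (3 * m + 4) * (182 + 100 * m))) ?_).mono (by omega)
      fun _ h => h
    -- With `T = ∅` and the prices `c_j / r`, the demand value is the welfare of the agent.
    refine runs_extendSet (T := ∅) (i := i) (x := 1 / I.reward)
      (hs₁.agree h12 (by simp) (by simp)) ?_ (by simp [hs₂, hc]) (by simp [hs₂]) ?_
    · rw [h12.readSet (by simp), h1.readSet (by simp), hT]
    intro s₃ h5 h6 h7 h8
    have h13 : Agree [3, 11] [3, 10, 11, 12] s₁ s₃ := h12.trans (h5.mono (by simp) (by simp))
    refine (runs_seq (C := 7) (C' := 13 + m * (54 + m + (3 * m + 4) * (182 + 100 * m)))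
      (runs_assignReal ?_)).mono (by omega) fun _ h => h
    simp only [NatExp.eval, RealExp.eval, h7, h8]
    set s₄ := s₃.setReal 13 0 (I.f (I.demandSet d ∅ i (1 / I.reward)) -
      ∑ j ∈ I.demandSet d ∅ i (1 / I.reward), I.demandPrice ∅ i (1 / I.reward) j) with hs₄
    have h14 : Agree [3, 11] [3, 10, 11, 12, 13] s₁ s₄ :=
      (h13.mono (by simp) (by simp)).setReal (by simp) _ _
    have hW : s₄.real 13 0 = I.welfare d i := by
      simp [hs₄, ContractSetting.welfare, ContractSetting.demandValue]
    refine (runs_forLoop (N := m) (C := 40 + m + (3 * m + 4) * (182 + 100 * m))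
      (fun j s' => Agree [3, 11, 12, 14, 18, 19] [3, 10, 11, 12, 13, 14, 15, 16] s₁ s' ∧
        (∀ k, s'.nat 19 k = 0) ∧ Found I d s' ∧ s₁.real 15 0 ≤ s'.real 15 0 ∧
        s'.real 13 0 = I.welfare d i ∧
        ∀ j' : Fin m, (j' : ℕ) < j → ∀ k < 3 * m + 4, PointBound I d i j' k (s'.real 15 0))
      ⟨h14.mono (by simp) (by simp), ?_, h3.agree h14 (by simp) (by simp), ?_, hW, ?_⟩
      ?_ ?_ ?_ ?_).mono ?_ fun _ h => h
    · intro k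
      rw [h14.1 19 (by simp), h2]
    · rw [h14.2 15 (by simp)]
    · exact fun j hj => absurd hj (Nat.not_lt_zero _)
    · rintro k s' v ⟨h9, h10, h11, h15, h16, h17⟩
      exact ⟨h9.setNat (by simp) _ _, by simpa using h10, by simpa [Found] using h11, h15, h16,
        h17⟩
    · rintro k s' ⟨h9, -⟩
      exact (hs₁.agree h9 (by simp) (by simp)).size
    · rintro j hj s' ⟨h9, h10, h11, h15, h16, h17⟩ hcj
      refine runs_tryAction hd (hs₁.agree h9 (by simp) (by simp)) ?_ h10 (i := ⟨i, hi⟩)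
        (j := ⟨j, hj⟩) (by rw [h9.1 10 (by simp), hc]) hcj h16 h11 ?_
      · rw [h9.readSet (by simp), h1.readSet (by simp), hT]
      intro s'' h18 h20 h21 h22 h23
      refine ⟨by rw [h18.1 14 (by simp), hcj], h9.trans (h18.mono (by simp) (by simp)), h20, h21,
        h15.trans h22, by rw [h18.2 13 (by simp), h16], fun j' hj' k hk hlt => ?_⟩
      rcases Nat.lt_succ_iff_lt_or_eq.1 hj' with h | h
      · exact (h17 j' h k hk hlt).trans h22
      · obtain rfl : j' = ⟨j, hj⟩ := Fin.ext h
        exact h23 k hk hlt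
    · rintro s' ⟨h9, h10, h11, h15, -, h17⟩
      refine ⟨by rw [h9.1 10 (by simp), hc], h1.trans (h9.mono (by simp) (by simp)), h10, h11,
        fun i' hi' j k hk hlt => ?_⟩
      rcases Nat.lt_succ_iff_lt_or_eq.1 hi' with h | rfl
      · exact (h4 i' h j k hk hlt).trans h15
      · exact h17 j j.2 k hk hlt
    · simp only [NatExp.size]
      ring_nf
      omega
  · rintro s' ⟨h1, -, h3, h4⟩
    exact hQ s' h1 h3 fun i j k hk => h4 i i.2 j k hk
  · simp [NatExp.size]

end RealRAM

namespace ContractSetting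

variable {n m : ℕ} {I : ContractSetting n m} {d : (Fin m → ℝ) → Finset (Fin m)}

/-! ### The greedy contract -/

/-- The factor by which the costs of an agent with share `k / (16 * n)` are scaled. -/
noncomputable def levelScale (I : ContractSetting n m) (k : ℕ) : ℝ :=
  16 * n / (k * I.reward)

theorem levelScale_nonneg (k : ℕ) : 0 ≤ I.levelScale k := by
  have := I.reward_pos
  unfold levelScale
  positivity

theorem levelScale_anti {k l : ℕ} (hk : 1 ≤ k) (hkl : k ≤ l) :
    I.levelScale l ≤ I.levelScale k := by
  have := I.reward_pos
  have : (0 : ℝ) < k := by exact_mod_cast hk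
  unfold levelScale
  gcongr

/-- The gain per share of raising the share of agent `i` by `k / (16 * n)`. -/
noncomputable def levelRatio (I : ContractSetting n m) (d : (Fin m → ℝ) → Finset (Fin m))
    (T : Finset (Fin m)) (i k : ℕ) : ℝ :=
  (I.demandValue d T i (I.levelScale k) - I.f T) / k

/-- If no ratio exceeds `ρ`, then every affordable set has at most the value
`2 * f T + 96 * n * ρ`. -/
theorem Affordable.half_sub_le (hI : I.IsSubmodular) (hd : IsDemandOracle I.f d)
    {T : Finset (Fin m)} {ρ : ℝ} (hρ0 : 0 ≤ ρ)
    (hρ : ∀ i < n, ∀ k < 2 * n, I.levelRatio d T i (k + 1) ≤ ρ) {S : Finset (Fin m)}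
    (hS : I.Affordable S) : I.f S / 2 - I.f T ≤ 48 * n * ρ := by
  obtain ⟨k, hk, hksum, hcost⟩ := hS
  have h1 := hI.f_union_biUnion_sub_le T Finset.univ fun i => S ∩ I.actions i
  rw [biUnion_inter_actions] at h1
  have h2 : ∀ i, I.f (T ∪ S ∩ I.actions i) - I.f T ≤
      k i * ρ + ∑ j ∈ S ∩ I.actions i, I.cost j * I.levelScale (k (I.agent j)) := by
    intro i
    have h3 := union_le_demandValue (T := T) hd (levelScale_nonneg (I := I) (k i)) i
      (U := S ∩ I.actions i) Finset.inter_subset_right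
    -- The level at which `S` is affordable is among those that the greedy algorithm tries; the
    -- shift matches the `k + 1` in `hρ`.
    have h4 := hρ i i.2 (k i - 1) (by have := hk i; omega)
    rw [Nat.sub_add_cancel (hk i).1, levelRatio,
      div_le_iff₀ (by exact_mod_cast (hk i).1)] at h4
    have h5 : ∑ j ∈ S ∩ I.actions i, I.cost j * I.levelScale (k (I.agent j)) =
        I.levelScale (k i) * ∑ j ∈ S ∩ I.actions i, I.cost j := by
      rw [Finset.mul_sum]
      refine Finset.sum_congr rfl fun j hj => ?_
      rw [mem_actions.1 (Finset.mem_inter.1 hj).2, mul_comm]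
    linarith
  have h3 := h1.trans (Finset.sum_le_sum fun i _ => h2 i)
  rw [Finset.sum_add_distrib, sum_inter_actions, ← Finset.sum_mul] at h3
  have h4 : (∑ i, (k i : ℝ)) * ρ ≤ 48 * n * ρ := by
    gcongr
    exact_mod_cast hksum
  have h5 := I.f_mono S (T ∪ S) Finset.subset_union_right
  simp only [levelScale] at h3
  linarith

/-- The invariant of the greedy algorithm: the shares `a i / (16 * n)` pay for the set `T`, and
the value of `T` keeps up with the total share `t / (16 * n)`. -/
structure GreedyInv (I : ContractSetting n m) (T : Finset (Fin m)) (a : ℕ → ℕ) (t : ℕ) :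
    Prop where
  sum_le : ∑ i : Fin n, a i ≤ t
  total_le : t ≤ 4 * n + 1
  one_le : ∀ j ∈ T, 1 ≤ a (I.agent j)
  cost_le : ∑ j ∈ T, I.cost j * I.levelScale (a (I.agent j)) ≤ I.f T
  value_ge : ∀ S, I.Affordable S → I.f S / 4 ≤ I.f T ∨ t * I.f S ≤ 192 * n * I.f T

theorem greedyInv_empty : I.GreedyInv ∅ (fun _ => 0) 0 where
  sum_le := by simp
  total_le := by omega
  one_le := by simp
  cost_le := by simp [I.f_empty]
  value_ge := fun S _ => Or.inr (by simp [I.f_empty])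

/-- A candidate `D` for the next set, which raises the share of agent `i` by `k / (16 * n)` at the
gain `ρ` per share. -/
structure Candidate (I : ContractSetting n m) (T D : Finset (Fin m)) (i k : ℕ) (ρ : ℝ) :
    Prop where
  subset : T ⊆ D
  agent_eq : ∀ j ∈ D, j ∉ T → (I.agent j : ℕ) = i
  one_le : 1 ≤ k
  le_max : k ≤ 2 * n + 1
  ratio_nonneg : 0 ≤ ρ
  gain_eq : I.f D - ∑ j ∈ D \ T, I.cost j * I.levelScale k - I.f T = ρ * k

/-- The starting point of each search. Level 1 rather than 0 makes every round raise the total share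
even without any gain. For `n = 0` it is the only candidate, hence the `+ 1` in `le_max`. -/
theorem candidate_self (T : Finset (Fin m)) : I.Candidate T T 0 1 0 where
  subset := le_rfl
  agent_eq := fun _ h h' => absurd h h'
  one_le := le_rfl
  le_max := by omega
  ratio_nonneg := le_rfl
  gain_eq := by simp

theorem candidate_demandSet (hd : IsDemandOracle I.f d) (T : Finset (Fin m)) (i : ℕ) {k : ℕ}
    (hk : k < 2 * n) : I.Candidate T (I.demandSet d T i (I.levelScale (k + 1))) i (k + 1)
      (I.levelRatio d T i (k + 1)) where
  subset := subset_demandSet i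
  agent_eq := fun _ => agent_eq_of_mem_demandSet hd (levelScale_nonneg _)
  one_le := by omega
  le_max := by omega
  ratio_nonneg := div_nonneg (sub_nonneg.2 (f_le_demandValue hd i)) (Nat.cast_nonneg _)
  gain_eq := by
    rw [levelRatio, div_mul_cancel₀ _ (by positivity), demandValue,
      sum_demandPrice_demandSet hd (levelScale_nonneg _)]

/-- Shares only grow, so old prices only fall, and the new actions, whose agent now has at least the
level `k`, are paid for out of their own gain. As long as the new set has less than a quarter of the
value of an affordable `S`, `Affordable.half_sub_le` gives `f S / 4 ≤ 48 * n * ρ`, so the value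
grows in proportion to the share spent. -/
theorem GreedyInv.step (hI : I.IsSubmodular) (hd : IsDemandOracle I.f d) {T D : Finset (Fin m)}
    {a a' : ℕ → ℕ} {t i k : ℕ} {ρ : ℝ} (h : I.GreedyInv T a t) (ht : t ≤ 2 * n)
    (hD : I.Candidate T D i k ρ)
    (hρ : ∀ i < n, ∀ k < 2 * n, I.levelRatio d T i (k + 1) ≤ ρ)
    (ha' : ∀ x, a' x = if x = i then a i + k else a x) : I.GreedyInv D a' (t + k) := by
  have haa' : ∀ x, a x ≤ a' x := fun x => by
    rw [ha']
    split_ifs with hx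
    · rw [hx]
      omega
    · exact le_rfl
  have hone : ∀ j ∈ D, 1 ≤ a' (I.agent j) := by
    intro j hj
    by_cases hjT : j ∈ T
    · exact (h.one_le j hjT).trans (haa' _)
    · rw [ha', if_pos (hD.agent_eq j hj hjT)]
      have := hD.one_le
      omega
  have hcnew : 0 ≤ ∑ j ∈ D \ T, I.cost j * I.levelScale k :=
    Finset.sum_nonneg fun j _ => mul_nonneg (I.cost_nonneg j) (levelScale_nonneg k)
  refine ⟨?_, by have := hD.le_max; omega, hone, ?_, fun S hS => ?_⟩
  · calc ∑ x : Fin n, a' x ≤ ∑ x : Fin n, (a x + if (x : ℕ) = i then k else 0) := by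
          refine Finset.sum_le_sum fun x _ => ?_
          rw [ha']
          split_ifs with hx
          · rw [hx]
          · omega
      _ = ∑ x : Fin n, a x + ∑ x : Fin n, if (x : ℕ) = i then k else 0 :=
        Finset.sum_add_distrib
      _ ≤ t + k := by
        refine add_le_add h.sum_le ?_
        -- The agent `0` of `candidate_self` does not exist if `n = 0`.
        by_cases hi : i < n
        · rw [Finset.sum_eq_single (⟨i, hi⟩ : Fin n)]
          · simp
          · intro b _ hb
            exact if_neg fun hbi => hb (Fin.ext hbi)
          · simp
        · rw [Finset.sum_eq_zero fun (x : Fin n) _ => if_neg fun hx : (x : ℕ) = i => hi (hx ▸ x.2)]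
          exact Nat.zero_le _
  · rw [← Finset.sum_sdiff hD.subset]
    have h1 : ∑ j ∈ D \ T, I.cost j * I.levelScale (a' (I.agent j)) ≤
        ∑ j ∈ D \ T, I.cost j * I.levelScale k := by
      refine Finset.sum_le_sum fun j hj => ?_
      obtain ⟨hjD, hjT⟩ := Finset.mem_sdiff.1 hj
      refine mul_le_mul_of_nonneg_left (levelScale_anti hD.one_le ?_) (I.cost_nonneg j)
      rw [ha', if_pos (hD.agent_eq j hjD hjT)]
      omega
    have h2 : ∑ j ∈ T, I.cost j * I.levelScale (a' (I.agent j)) ≤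
        ∑ j ∈ T, I.cost j * I.levelScale (a (I.agent j)) := by
      refine Finset.sum_le_sum fun j hj => ?_
      exact mul_le_mul_of_nonneg_left (levelScale_anti (h.one_le j hj) (haa' _))
        (I.cost_nonneg j)
    have h3 := h.cost_le
    have h4 := hD.gain_eq
    have h5 := mul_nonneg hD.ratio_nonneg (Nat.cast_nonneg (α := ℝ) k)
    linarith
  · by_cases h1 : I.f S / 4 ≤ I.f D
    · exact Or.inl h1
    · right
      have h2 := I.f_mono T D hD.subset
      have h3 := hS.half_sub_le hI hd hD.ratio_nonneg hρ
      have h4 := (h.value_ge S hS).resolve_left (by linarith)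
      have h5 : I.f S / 4 * k ≤ 48 * n * ρ * k := by
        gcongr
        linarith
      have h6 : ρ * k ≤ I.f D - I.f T := by linarith [hD.gain_eq]
      have h7 : 192 * n * (ρ * k) ≤ 192 * n * (I.f D - I.f T) := by gcongr
      push_cast
      linarith

/-- Either alternative of `value_ge` suffices: the factor is 4, or `192 * n / (2 * n) = 96` by the
stopping rule. -/
theorem GreedyInv.affordable_le {T : Finset (Fin m)} {a : ℕ → ℕ} {t : ℕ}
    (h : I.GreedyInv T a t) (ht : 2 * n < t) {S : Finset (Fin m)} (hS : I.Affordable S) :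
    I.f S ≤ 96 * I.f T := by
  have hT := I.f_nonneg T
  have hfS := I.f_nonneg S
  rcases h.value_ge S hS with h1 | h1
  · linarith
  · rcases Nat.eq_zero_or_pos n with rfl | hn
    · obtain rfl : S = ∅ := Finset.eq_empty_iff_forall_notMem.2 fun j _ => (I.agent j).elim0
      rw [I.f_empty]
      positivity
    · have hn' : (0 : ℝ) < n := by exact_mod_cast hn
      have ht' : 2 * (n : ℝ) ≤ t := by exact_mod_cast ht.le
      have h2 : 2 * (n : ℝ) * I.f S ≤ t * I.f S := by gcongr
      have h3 : 2 * n * I.f S ≤ 2 * n * (96 * I.f T) := by linarith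
      exact le_of_mul_le_mul_left h3 (by positivity)

/-- The shares of the greedy contract. -/
theorem GreedyInv.contract {T : Finset (Fin m)} {a : ℕ → ℕ} {t : ℕ} (h : I.GreedyInv T a t)
    (hI : I.IsSubmodular) {γ : Fin n → ℝ} (hγ : ∀ i, γ i = a i / (8 * n)) :
    IsContract γ ∧ ∀ S, I.IsNash γ S → 3 / 16 * I.f T * I.reward ≤ I.principalUtility γ S := by
  have hr := I.reward_pos
  have hγ0 : ∀ i, 0 ≤ γ i := fun i => by rw [hγ]; positivity
  -- `(4 * n + 1) / (8 * n) ≤ 5 / 8` for `n ≥ 1`, so the principal keeps at least 3/8.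
  have hsum : ∑ i, γ i ≤ 5 / 8 := by
    rcases Nat.eq_zero_or_pos n with rfl | hn
    · simp
      norm_num
    · have hn' : (1 : ℝ) ≤ n := by exact_mod_cast hn
      simp only [hγ]
      rw [← Finset.sum_div, div_le_iff₀ (by positivity)]
      have : (∑ i : Fin n, (a i : ℝ)) ≤ 4 * n + 1 := by
        exact_mod_cast h.sum_le.trans h.total_le
      linarith
  refine ⟨fun i => ⟨hγ0 i, ?_⟩, fun S hS => ?_⟩
  · have := Finset.single_le_sum (f := γ) (fun i _ => hγ0 i) (Finset.mem_univ i)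
    linarith
  · have h1 := hS.le_f hI T fun j hj => by
      have h2 : (1 : ℝ) ≤ a (I.agent j) := by exact_mod_cast h.one_le j hj
      have h3 : (0 : ℝ) < n := by exact_mod_cast (I.agent j).pos
      rw [hγ]
      positivity
    -- The denominator `8 * n` in place of `16 * n` doubles the shares and halves the prices, which
    -- the greedy invariant bounds by `f T`; half of `f T` is left.
    have h2 : ∑ j ∈ T, I.cost j / (γ (I.agent j) * I.reward) =
        (∑ j ∈ T, I.cost j * I.levelScale (a (I.agent j))) / 2 := by
      rw [Finset.sum_div]
      refine Finset.sum_congr rfl fun j hj => ?_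
      have h2 : (0 : ℝ) < a (I.agent j) := by exact_mod_cast h.one_le j hj
      have h3 : (0 : ℝ) < n := by exact_mod_cast (I.agent j).pos
      rw [hγ, levelScale]
      field_simp
      ring
    rw [h2] at h1
    have h3 := h.cost_le
    have h4 : I.f T / 2 ≤ I.f S := by linarith
    unfold principalUtility
    refine mul_le_mul_of_nonneg_right ?_ hr.le
    have := I.f_nonneg T
    nlinarith

end ContractSetting

/-! ### The greedy algorithm as a program. -/

namespace RealRAM

variable {n m : ℕ} {I : ContractSetting n m} {d : (Fin m → ℝ) → Finset (Fin m)}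
  {s : State} {Q : State → Prop}

/-- The next level of an agent, from the loop variable `12`. -/
abbrev levelExp : NatExp := .add (natVar 12) (.lit 1)

/-- Compare the best candidate so far, in array `4`, the variables `15` and `16` and the real
variable `18`, with the one for the agent in variable `10` and the next level. -/
def tryLevel : Program :=
  .seq (.assignReal 10 (.lit 0) (.div (.mul (.ofNat (.lit 16)) (.ofNat agentsExp))
    (.mul (.ofNat levelExp) (realVar 1)))) <|
  .seq extendSet <|
  .seq (.assignReal 14 (.lit 0)
    (.div (.sub (.sub (realVar 11) (realVar 12)) (realVar 17)) (.ofNat levelExp))) <|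
  .ite (.realLe (realVar 14) (realVar 18)) .skip <|
  .seq (.assignReal 18 (.lit 0) (realVar 14)) <|
  .seq (.assignNat 15 (.lit 0) (natVar 10)) <|
  .seq (.assignNat 16 (.lit 0) levelExp) <|
  copySet 3 4

theorem runs_tryLevel (hd : IsDemandOracle I.f d) (hs : Holds I s) {T : Finset (Fin m)}
    (hT : s.readSet m 2 = T) (hfT : s.real 17 0 = I.f T) {i k : ℕ} (hi : s.nat 10 0 = i)
    (hk : s.nat 12 0 = k) (hkn : k < 2 * n)
    (hC : I.Candidate T (s.readSet m 4) (s.nat 15 0) (s.nat 16 0) (s.real 18 0))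
    (hQ : ∀ s', Agree [3, 4, 11, 15, 16] [3, 10, 11, 12, 14, 18] s s' →
      I.Candidate T (s'.readSet m 4) (s'.nat 15 0) (s'.nat 16 0) (s'.real 18 0) →
      s.real 18 0 ≤ s'.real 18 0 → I.levelRatio d T i (k + 1) ≤ s'.real 18 0 → Q s') :
    Runs I.f d tryLevel (164 + 120 * m) Q s := by
  have hcand := ContractSetting.candidate_demandSet (I := I) hd T i hkn
  refine (runs_seq (C := 17) (C' := 147 + 120 * m) (runs_assignReal ?_)).mono (by omega)
    fun _ h => h
  simp only [NatExp.eval, RealExp.eval, hs.agents, hs.reward, hk]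
  set D := I.demandSet d T i (I.levelScale (k + 1)) with hD
  set s₁ := s.setReal 10 0 (((16 : ℕ) : ℝ) * (n : ℝ) / (((k + 1 : ℕ) : ℝ) * I.reward)) with hs₁
  have h1 : Agree [3, 4, 11, 15, 16] [3, 10, 11, 12, 14, 18] s s₁ :=
    (Agree.refl _ _ _).setReal (by simp) _ _
  refine (runs_seq (C := 100 + 100 * m) (C' := 47 + 20 * m) ?_).mono (by omega) fun _ h => h
  refine runs_extendSet (T := T) (i := i) (x := I.levelScale (k + 1))
    (hs.agree h1 (by simp) (by simp)) hT (by simp [hs₁, hi])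
    (by simp [hs₁, ContractSetting.levelScale]) ?_
  intro s₂ h2 h3 h4 h5
  rw [← hD] at h3 h4 h5
  have h12 := h1.trans (h2.mono (by simp) (by simp))
  refine (runs_seq (C := 16) (C' := 31 + 20 * m) (runs_assignReal ?_)).mono (by omega)
    fun _ h => h
  have h4_agree : s₂.readSet m 4 = s.readSet m 4 := by
    rw [h2.readSet (by simp)]
    rfl
  have h15 : s₂.nat 15 0 = s.nat 15 0 := by rw [h2.1 15 (by simp)]; rfl
  have h16 : s₂.nat 16 0 = s.nat 16 0 := by rw [h2.1 16 (by simp)]; rfl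
  have h18 : s₂.real 18 0 = s.real 18 0 := by rw [h2.2 18 (by simp)]; simp [hs₁]
  have hratio : (I.f D - ∑ j ∈ D, I.demandPrice T i (I.levelScale (k + 1)) j - I.f T) /
      ((k + 1 : ℕ) : ℝ) = I.levelRatio d T i (k + 1) := rfl
  simp only [NatExp.eval, RealExp.eval, h12.1 12 (by simp), h12.2 17 (by simp), hfT, hk, h4, h5,
    hratio]
  set ρ := I.levelRatio d T i (k + 1) with hρ
  set s₃ := s₂.setReal 14 0 ρ with hs₃
  have h13 : Agree [3, 4, 11, 15, 16] [3, 10, 11, 12, 14, 18] s s₃ :=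
    h12.setReal (by simp) _ _
  have h14 : s₃.real 14 0 = ρ := by simp [hs₃]
  have h18' : s₃.real 18 0 = s.real 18 0 := by simp [hs₃, h18]
  refine (runs_ite (C := 25 + 20 * m) (fun hb => ?_) fun hb => ?_).mono
    (by simp [Test.size, NatExp.size, RealExp.size]; omega) fun _ h => h
  · simp only [Test.eval, NatExp.eval, RealExp.eval, h14, h18'] at hb
    refine (runs_skip (hQ s₃ h13 ?_ h18'.ge (by rwa [h18']))).mono (by omega) fun _ h => h
    rw [h18', show s₃.readSet m 4 = s.readSet m 4 from h4_agree,
      show s₃.nat 15 0 = s.nat 15 0 from h15, show s₃.nat 16 0 = s.nat 16 0 from h16]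
    exact hC
  · simp only [Test.eval, NatExp.eval, RealExp.eval, h14, h18', not_le] at hb
    refine (runs_seq (C := 4) (C' := 21 + 20 * m) (runs_assignReal ?_)).mono (by omega)
      fun _ h => h
    refine (runs_seq (C := 4) (C' := 17 + 20 * m) (runs_assignNat ?_)).mono (by omega)
      fun _ h => h
    refine (runs_seq (C := 6) (C' := 11 + 20 * m) (runs_assignNat ?_)).mono (by omega)
      fun _ h => h
    simp only [NatExp.eval, RealExp.eval, h14, nat_setReal, nat_setNat]
    norm_num only [false_and, if_false]
    have h10 : s₃.nat 10 0 = i := by rw [h13.1 10 (by simp), hi]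
    have h12' : s₃.nat 12 0 = k := by rw [h13.1 12 (by simp), hk]
    rw [h10, h12']
    set s₄ := ((s₃.setReal 18 0 ρ).setNat 15 0 i).setNat 16 0 (k + 1) with hs₄
    have h17 : Agree [3, 4, 11, 15, 16] [3, 10, 11, 12, 14, 18] s s₄ :=
      ((h13.setReal (by simp) _ _).setNat (by simp) _ _).setNat (by simp) _ _
    refine (runs_copySet (hs.agree h17 (by simp) (by simp)) (by norm_num) (by norm_num)
      (by norm_num) (by norm_num) (by norm_num) ?_).mono (by omega) fun _ h => h
    intro s₅ h19 h20
    have e15 : s₅.nat 15 0 = i := by rw [h19.1 15 (by simp)]; simp [hs₄]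
    have e16 : s₅.nat 16 0 = k + 1 := by rw [h19.1 16 (by simp)]; simp [hs₄]
    have e18 : s₅.real 18 0 = ρ := by rw [h19.2 18 (by simp)]; simp [hs₄]
    have e4 : s₅.readSet m 4 = D := by
      rw [h20, hs₄, readSet_setNat_of_ne (by norm_num), readSet_setNat_of_ne (by norm_num)]
      exact h3
    refine hQ s₅ (h17.trans (h19.mono (by simp) (by simp))) ?_ ?_ ?_
    · rw [e15, e16, e18, e4]
      exact hcand
    · rw [e18]
      exact hb.le
    · rw [e18]

/-- Search all candidates. -/
def searchCandidate : Program :=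
  forLoop 10 agentsExp (forLoop 12 (.add agentsExp agentsExp) tryLevel)

theorem runs_searchCandidate (hd : IsDemandOracle I.f d) (hs : Holds I s) {T : Finset (Fin m)}
    (hT : s.readSet m 2 = T) (hfT : s.real 17 0 = I.f T)
    (hC : I.Candidate T (s.readSet m 4) (s.nat 15 0) (s.nat 16 0) (s.real 18 0))
    (hQ : ∀ s', Agree [3, 4, 10, 11, 12, 15, 16] [3, 10, 11, 12, 14, 18] s s' →
      I.Candidate T (s'.readSet m 4) (s'.nat 15 0) (s'.nat 16 0) (s'.real 18 0) →
      (∀ i < n, ∀ k < 2 * n, I.levelRatio d T i (k + 1) ≤ s'.real 18 0) → Q s') :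
    Runs I.f d searchCandidate (11 + n * (28 + 2 * n * (181 + 120 * m))) Q s := by
  refine (runs_forLoop (N := n) (C := 14 + 2 * n * (181 + 120 * m))
    (fun i s' => Agree [3, 4, 10, 11, 12, 15, 16] [3, 10, 11, 12, 14, 18] s s' ∧
      I.Candidate T (s'.readSet m 4) (s'.nat 15 0) (s'.nat 16 0) (s'.real 18 0) ∧
      ∀ i' < i, ∀ k < 2 * n, I.levelRatio d T i' (k + 1) ≤ s'.real 18 0)
    ⟨.refl _ _ _, hC, fun i hi => absurd hi (Nat.not_lt_zero _)⟩ ?_ ?_ ?_ ?_).mono ?_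
    fun _ h => h
  · rintro k s' v ⟨h1, h2, h3⟩
    refine ⟨h1.setNat (by simp) _ _, ?_, h3⟩
    rw [readSet_setNat_of_ne (by norm_num)]
    simpa using h2
  · rintro k s' ⟨h1, -⟩
    exact (hs.agree h1 (by simp) (by simp)).agents
  · rintro i hi s₁ ⟨h1, h2, h3⟩ hc
    have hs₁ := hs.agree h1 (by simp) (by simp)
    refine (runs_forLoop (N := 2 * n) (C := 164 + 120 * m)
      (fun k s' => Agree [3, 4, 11, 12, 15, 16] [3, 10, 11, 12, 14, 18] s₁ s' ∧
        I.Candidate T (s'.readSet m 4) (s'.nat 15 0) (s'.nat 16 0) (s'.real 18 0) ∧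
        s₁.real 18 0 ≤ s'.real 18 0 ∧
        ∀ k' < k, I.levelRatio d T i (k' + 1) ≤ s'.real 18 0)
      ⟨.refl _ _ _, h2, le_rfl, fun i hi => absurd hi (Nat.not_lt_zero _)⟩ ?_ ?_ ?_ ?_).mono ?_
      fun _ h => h
    · rintro k s' v ⟨h4, h5, h6, h7⟩
      refine ⟨h4.setNat (by simp) _ _, ?_, h6, h7⟩
      rw [readSet_setNat_of_ne (by norm_num)]
      simpa using h5
    · rintro k s' ⟨h4, -⟩
      simp only [NatExp.eval, (hs₁.agree h4 (by simp) (by simp)).agents]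
      omega
    · rintro k hk s' ⟨h4, h5, h6, h7⟩ hck
      have h14 := h1.trans (h4.mono (by simp) (by simp))
      refine runs_tryLevel hd (hs₁.agree h4 (by simp) (by simp))
        (by rw [h14.readSet (by simp), hT]) (by rw [h14.2 17 (by simp), hfT])
        (by rw [h4.1 10 (by simp), hc]) hck hk h5 ?_
      intro s'' h8 h9 h10 h11
      refine ⟨by rw [h8.1 12 (by simp), hck], h4.trans (h8.mono (by simp) (by simp)), h9,
        h6.trans h10, fun k' hk' => ?_⟩
      rcases Nat.lt_succ_iff_lt_or_eq.1 hk' with h | rfl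
      · exact (h7 k' h).trans h10
      · exact h11
    · rintro s' ⟨h4, h5, h6, h7⟩
      refine ⟨by rw [h4.1 10 (by simp), hc], h1.trans (h4.mono (by simp) (by simp)), h5,
        fun i' hi' k hk => ?_⟩
      rcases Nat.lt_succ_iff_lt_or_eq.1 hi' with h | rfl
      · exact (h3 i' h k hk).trans h6
      · exact h7 k hk
    · simp only [NatExp.size]
      ring_nf
      omega
  · rintro s' ⟨h1, h2, h3⟩
    exact hQ s' h1 h2 h3
  · simp only [NatExp.size]
    ring_nf
    omega

/-- One round of the greedy algorithm: unless the total share, in variable `17`, is large, extend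
the set in array `2`, of value in the real variable `17`, to the best candidate, and raise the
levels in array `5` accordingly. -/
def greedyRound : Program :=
  .ite (.natLe (natVar 17) (.add agentsExp agentsExp))
    (.seq (copySet 2 4) <|
      .seq (.assignNat 16 (.lit 0) (.lit 1)) <|
      .seq (.assignNat 15 (.lit 0) (.lit 0)) <|
      .seq (.assignReal 18 (.lit 0) (.ofNat (.lit 0))) <|
      .seq searchCandidate <|
      .seq (copySet 4 2) <|
      .seq (.assignNat 5 (natVar 15) (.add (.get 5 (natVar 15)) (natVar 16))) <|
      .seq (.assignNat 17 (.lit 0) (.add (natVar 17) (natVar 16))) <|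
      .valueQuery 2 17 (.lit 0))
    .skip

/-- A bound on the cost of one round of the greedy algorithm. -/
def greedyRoundCost (n m : ℕ) : ℕ :=
  71 + 41 * m + n * (28 + 2 * n * (181 + 120 * m))

/-- The invariant of the greedy algorithm, for the memory. -/
def GreedyState (I : ContractSetting n m) (s : State) : Prop :=
  I.GreedyInv (s.readSet m 2) (s.nat 5) (s.nat 17 0) ∧ s.real 17 0 = I.f (s.readSet m 2)

theorem runs_greedyRound (hI : I.IsSubmodular) (hd : IsDemandOracle I.f d) (hs : Holds I s)
    (hG : GreedyState I s)
    (hQ : ∀ s', Agree [2, 3, 4, 5, 10, 11, 12, 15, 16, 17] [3, 10, 11, 12, 14, 17, 18] s s' →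
      GreedyState I s' → (2 * n < s'.nat 17 0 ∨ s.nat 17 0 + 1 ≤ s'.nat 17 0) → Q s') :
    Runs I.f d greedyRound (greedyRoundCost n m) Q s := by
  refine (runs_ite (C := 62 + 41 * m + n * (28 + 2 * n * (181 + 120 * m))) (fun hb => ?_)
    fun hb => ?_).mono
    (by simp [Test.size, NatExp.size, greedyRoundCost]; omega) fun _ h => h
  · simp only [Test.eval, NatExp.eval, hs.agents] at hb
    set T := s.readSet m 2 with hT
    set c := n * (28 + 2 * n * (181 + 120 * m))
    refine (runs_seq (C := 11 + m * 20) (C' := 51 + 21 * m + c) ?_).mono (by omega)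
      fun _ h => h
    refine runs_copySet hs (by norm_num) (by norm_num)
      (by norm_num) (by norm_num) (by norm_num) ?_
    intro s₁ h1 h2
    refine (runs_seq (C := 3) (C' := 48 + 21 * m + c) (runs_assignNat ?_)).mono (by omega)
      fun _ h => h
    refine (runs_seq (C := 3) (C' := 45 + 21 * m + c) (runs_assignNat ?_)).mono (by omega)
      fun _ h => h
    refine (runs_seq (C := 4) (C' := 41 + 21 * m + c) (runs_assignReal ?_)).mono (by omega)
      fun _ h => h
    simp only [NatExp.eval, RealExp.eval, Nat.cast_zero]
    set s₂ := ((s₁.setNat 16 0 1).setNat 15 0 0).setReal 18 0 0 with hs₂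
    have h12 : Agree [4, 11, 15, 16] [18] s s₂ :=
      (((h1.mono (by simp) (by simp)).setNat (by simp) _ _).setNat (by simp) _ _).setReal
        (by simp) _ _
    have h4 : s₂.readSet m 4 = T := by
      refine Eq.trans ?_ h2
      change ((s₁.setNat 16 0 1).setNat 15 0 0).readSet m 4 = _
      rw [readSet_setNat_of_ne (by norm_num), readSet_setNat_of_ne (by norm_num)]
    refine (runs_seq (C := 11 + c) (C' := 30 + 21 * m) ?_).mono (by omega) fun _ h => h
    refine runs_searchCandidate (T := T) hd (hs.agree h12 (by simp) (by simp))
      (h12.readSet (by simp)) (by rw [h12.2 17 (by simp), hG.2]) ?_ ?_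
    · rw [h4, show s₂.nat 15 0 = 0 by simp [hs₂], show s₂.nat 16 0 = 1 by simp [hs₂],
        show s₂.real 18 0 = 0 by simp [hs₂]]
      exact ContractSetting.candidate_self T
    intro s₃ h5 h6 h7
    have h13 : Agree [3, 4, 10, 11, 12, 15, 16] [3, 10, 11, 12, 14, 18] s s₃ :=
      (h12.mono (by simp) (by simp)).trans h5
    set D := s₃.readSet m 4 with hD
    set i := s₃.nat 15 0 with hi
    set k := s₃.nat 16 0 with hk
    refine (runs_seq (C := 11 + m * 20) (C' := 19 + m) ?_).mono (by omega) fun _ h => h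
    refine runs_copySet (hs.agree h13 (by simp) (by simp)) (by norm_num) (by norm_num)
      (by norm_num) (by norm_num) (by norm_num) ?_
    intro s₄ h8 h9
    have h14 : Agree [2, 3, 4, 5, 10, 11, 12, 15, 16, 17] [3, 10, 11, 12, 14, 17, 18] s s₄ :=
      (h13.mono (by simp) (by simp)).trans (h8.mono (by simp) (by simp))
    refine (runs_seq (C := 9) (C' := 10 + m) (runs_assignNat ?_)).mono (by omega) fun _ h => h
    refine (runs_seq (C := 7) (C' := 3 + m) (runs_assignNat ?_)).mono (by omega) fun _ h => h
    have e15 : s₄.nat 15 0 = i := by rw [h8.1 15 (by simp)]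
    have e16 : s₄.nat 16 0 = k := by rw [h8.1 16 (by simp)]
    have e5 : s₄.nat 5 = s.nat 5 := by rw [h8.1 5 (by simp), h13.1 5 (by simp)]
    have e17 : s₄.nat 17 0 = s.nat 17 0 := by rw [h8.1 17 (by simp), h13.1 17 (by simp)]
    simp only [NatExp.eval, nat_setNat]
    norm_num only [false_and, if_false]
    rw [e15, e16, e5, e17]
    set s₅ := (s₄.setNat 5 i (s.nat 5 i + k)).setNat 17 0 (s.nat 17 0 + k) with hs₅
    have h15 : Agree [2, 3, 4, 5, 10, 11, 12, 15, 16, 17] [3, 10, 11, 12, 14, 17, 18] s s₅ :=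
      (h14.setNat (by simp) _ _).setNat (by simp) _ _
    have hset : s₅.readSet m 2 = D := by
      rw [hs₅, readSet_setNat_of_ne (by norm_num), readSet_setNat_of_ne (by norm_num), h9]
    refine (runs_valueQuery ?_).mono (by simp [NatExp.size]; omega) fun _ h => h
    rw [hset]
    refine hQ _ (h15.setReal (by simp) _ _) ⟨?_, ?_⟩ (Or.inr ?_)
    · change I.GreedyInv (s₅.readSet m 2) (s₅.nat 5) (s₅.nat 17 0)
      rw [hset, show s₅.nat 17 0 = s.nat 17 0 + k by simp [hs₅]]
      refine hG.1.step hI hd (by omega) h6 h7 fun x => ?_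
      simp [hs₅, e5]
    · change _ = I.f (s₅.readSet m 2)
      simp [NatExp.eval, hset]
    · have := h6.one_le
      simp [hs₅]
      omega
  · simp only [Test.eval, NatExp.eval, hs.agents] at hb
    exact (runs_skip (hQ s (.refl _ _ _) hG (Or.inl (by omega)))).mono (by omega) fun _ h => h

/-- The greedy algorithm. -/
def greedy : Program :=
  forLoop 13 (.add (.add agentsExp agentsExp) (.lit 1)) greedyRound

/-- Until it exceeds `2 * n`, the total level rises by at least 1 per round, so `2 * n + 1` rounds
suffice. -/
theorem runs_greedy (hI : I.IsSubmodular) (hd : IsDemandOracle I.f d) (hs : Holds I s)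
    (hG : GreedyState I s)
    (hQ : ∀ s', Agree [2, 3, 4, 5, 10, 11, 12, 13, 15, 16, 17] [3, 10, 11, 12, 14, 17, 18] s s' →
      GreedyState I s' → 2 * n < s'.nat 17 0 → Q s') :
    Runs I.f d greedy (16 + (2 * n + 1) * (greedyRoundCost n m + 19)) Q s := by
  refine (runs_forLoop (N := 2 * n + 1) (C := greedyRoundCost n m)
    (fun k s' => Agree [2, 3, 4, 5, 10, 11, 12, 13, 15, 16, 17] [3, 10, 11, 12, 14, 17, 18] s s' ∧
      GreedyState I s' ∧ (2 * n < s'.nat 17 0 ∨ k ≤ s'.nat 17 0))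
    ⟨.refl _ _ _, hG, Or.inr (Nat.zero_le _)⟩ ?_ ?_ ?_ ?_).mono ?_ fun _ h => h
  · rintro k s' v ⟨h1, ⟨h2, h2'⟩, h3⟩
    have e5 : (s'.setNat 13 0 v).nat 5 = s'.nat 5 := by ext; simp
    refine ⟨h1.setNat (by simp) _ _, ⟨?_, ?_⟩, by simpa using h3⟩
    · rw [readSet_setNat_of_ne (by norm_num), e5]
      simpa using h2
    · rw [readSet_setNat_of_ne (by norm_num)]
      exact h2'
  · rintro k s' ⟨h1, -⟩
    simp only [NatExp.eval, (hs.agree h1 (by simp) (by simp)).agents]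
    omega
  · rintro k hk s' ⟨h1, h2, h3⟩ hc
    refine runs_greedyRound hI hd (hs.agree h1 (by simp) (by simp)) h2 ?_
    intro s'' h4 h5 h6
    exact ⟨by rw [h4.1 13 (by simp), hc], h1.trans (h4.mono (by simp) (by simp)), h5, by omega⟩
  · rintro s' ⟨h1, h2, h3⟩
    exact hQ s' h1 h2 (by omega)
  · simp only [NatExp.size]
    ring_nf
    omega

end RealRAM

namespace RealRAM

variable {n m : ℕ} {I : ContractSetting n m} {d : (Fin m → ℝ) → Finset (Fin m)}
  {s : State} {Q : State → Prop}

/-! ### The algorithm -/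

/-- Write the better one of the two contracts to array `2` of real numbers. -/
def writeContract : Program :=
  .ite (.realLe (realVar 15) (.mul (.ofNat (.lit 768)) (realVar 17)))
    (forLoop 10 agentsExp (.assignReal 2 (natVar 10)
      (.div (.ofNat (.get 5 (natVar 10))) (.mul (.ofNat (.lit 8)) (.ofNat agentsExp)))))
    (.assignReal 2 (natVar 18) (.div (.add (.ofNat (.lit 1)) (realVar 16)) (.ofNat (.lit 2))))

theorem runs_writeContract (hs : Holds I s) (h2 : ∀ i, s.real 2 i = 0)
    (hgreedy : s.real 15 0 ≤ 768 * s.real 17 0 →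
      ∀ s', (∀ i : Fin n, output n s' i = s.nat 5 i / (8 * n)) → Q s')
    (hsingle : 768 * s.real 17 0 < s.real 15 0 →
      ∀ s', (∀ i : Fin n, output n s' i =
        if (i : ℕ) = s.nat 18 0 then (1 + s.real 16 0) / 2 else 0) → Q s') :
    Runs I.f d writeContract (22 + n * 28) Q s := by
  refine (runs_ite (C := 11 + n * 28) (fun hb => ?_) fun hb => ?_).mono
    (by simp [Test.size, NatExp.size, RealExp.size]; omega) fun _ h => h
  · simp only [Test.eval, NatExp.eval, RealExp.eval, Nat.cast_ofNat] at hb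
    refine (runs_forLoop (N := n) (C := 14)
      (fun k s' => Agree [10] [2] s s' ∧
        ∀ i : Fin n, (i : ℕ) < k → s'.real 2 i = s.nat 5 i / (8 * n))
      ⟨.refl _ _ _, fun j hj => absurd hj (Nat.not_lt_zero _)⟩ ?_ ?_ ?_ ?_).mono
      (by simp [NatExp.size]) fun _ h => h
    · rintro k s' v ⟨h3, h4⟩
      exact ⟨h3.setNat (by simp) _ _, h4⟩
    · rintro k s' ⟨h3, -⟩
      exact (hs.agree h3 (by simp) (by simp)).agents
    · rintro k hk s' ⟨h3, h4⟩ hc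
      refine (runs_assignReal ?_).mono (by simp [NatExp.size, RealExp.size]) fun _ h => h
      simp only [NatExp.eval, RealExp.eval, hc, (hs.agree h3 (by simp) (by simp)).agents,
        h3.1 5 (by simp), Nat.cast_ofNat]
      refine ⟨hc, h3.setReal (by simp) _ _, fun i hi => ?_⟩
      rw [real_setReal]
      split_ifs with h
      · rw [h.2]
      · exact h4 i (by simp at h; omega)
    · rintro s' ⟨-, h4⟩
      exact hgreedy hb s' fun i => h4 i i.2
  · simp only [Test.eval, NatExp.eval, RealExp.eval, Nat.cast_ofNat, not_le] at hb
    refine (runs_assignReal ?_).mono (by simp [NatExp.size, RealExp.size]) fun _ h => h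
    -- The other entries of array `2` are still `0`, so only one agent is paid.
    refine hsingle hb _ fun i => ?_
    simp [output, State.readVec, NatExp.eval, RealExp.eval, h2]

/-- The approximation algorithm. -/
def contractProgram : Program :=
  .seq searchSingle (.seq greedy writeContract)

/-- A bound on the total cost of the approximation algorithm. -/
def contractCost (n m : ℕ) : ℕ :=
  11 + n * (searchAgentCost m + 14) + (16 + (2 * n + 1) * (greedyRoundCost n m + 19) +
    (22 + n * 28))

theorem runs_contractProgram (hI : I.IsSubmodular) (hd : IsDemandOracle I.f d) :
    Runs I.f d contractProgram (contractCost n m) (fun s =>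
      ContractSetting.IsContract (output n s) ∧ ∀ S, I.IsNash (output n s) S →
        1 / 10 ^ 8 * I.optUtility ≤ I.principalUtility (output n s) S) (input I) := by
  have hr := I.reward_pos
  have hs := holds_input I
  refine runs_seq (runs_searchSingle hd hs (by ext; simp [mem_readSet, input])
    (by simp [input]) (by simp [input]) ?_)
  intro s₁ h1 hF hgrid
  have hset : s₁.readSet m 2 = ∅ := by
    rw [h1.readSet (by simp)]
    ext
    simp [mem_readSet, input]
  refine runs_seq (runs_greedy hI hd (hs.agree h1 (by simp) (by simp)) ⟨?_, ?_⟩ ?_)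
  · rw [hset, h1.1 5 (by simp), h1.1 17 (by simp)]
    simpa [input] using ContractSetting.greedyInv_empty (I := I)
  · rw [hset, h1.2 17 (by simp), I.f_empty]
    simp [input]
  intro s₂ h2 ⟨hG, hfT⟩ ht
  have h12 := (h1.mono (A' := [2, 3, 4, 5, 10, 11, 12, 13, 14, 15, 16, 17, 18, 19])
    (B' := [3, 10, 11, 12, 13, 14, 15, 16, 17, 18]) (by simp) (by simp)).trans
      (h2.mono (by simp) (by simp))
  have hF₂ := hF.agree h2 (by simp) (by simp)
  rw [← h2.2 15 (by simp)] at hgrid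
  set T := s₂.readSet m 2 with hT
  have hM₂ := I.f_nonneg T
  have haff : ∀ S, I.Affordable S → I.f S ≤ 96 * I.f T := fun S hS => hG.affordable_le ht hS
  have hopt := ContractSetting.optUtility_le hI hd hgrid hF₂.1 haff hM₂
  refine runs_writeContract (hs.agree h12 (by simp) (by simp)) (fun i => ?_) ?_ ?_
  · rw [h12.2 2 (by simp)]
    simp [input]
  · intro hle s₃ h3
    rw [hfT] at hle
    obtain ⟨h4, h5⟩ := hG.contract hI h3
    refine ⟨h4, fun S hS => le_trans ?_ (h5 S hS)⟩
    -- `8192 * 768 + 6240` is less than `10 ^ 7`, so a fraction `10 ^ (-8)` of the optimum stays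
    -- below `3 / 16 * f T * r`.
    have h6 : (8192 * s₂.real 15 0 + 6240 * I.f T) * I.reward ≤
        (8192 * (768 * I.f T) + 6240 * I.f T) * I.reward := by gcongr
    have h7 := mul_nonneg hM₂ hr.le
    linarith
  · intro hlt s₃ h3
    rw [hfT] at hlt
    obtain ⟨i, hi, ha0, ha1, hM⟩ := hF₂.2.resolve_left (by linarith)
    set a := s₂.real 16 0 with ha
    rw [hi] at h3
    have hγi : output n s₃ i = (1 + a) / 2 := by rw [h3, if_pos rfl]
    have hγ : ∀ i', i' ≠ i → output n s₃ i' = 0 := fun i' hi' => by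
      rw [h3, if_neg fun h => hi' (Fin.ext h)]
    refine ⟨fun i' => ?_, fun S hS => ?_⟩
    · by_cases h : i' = i
      · rw [h, hγi]
        constructor <;> linarith
      · rw [hγ i' h]
        exact ⟨le_rfl, zero_le_one⟩
    -- The threshold is `768 = 8 * 96`: free actions form affordable sets, worth at most `96 * f T`,
    -- which is below an eighth of the single-agent value.
    · have h4 := hS.three_mul_response_le hI hd (M := s₂.real 15 0) (fun S hS => by
        linarith [haff S (ContractSetting.affordable_of_cost_eq_zero hS)]) ha0 ha1 hM hγi hγ
      have h5 : ∑ i, output n s₃ i = (1 + a) / 2 := by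
        rw [Finset.sum_eq_single i (fun i' _ h => hγ i' h) (by simp), hγi]
      rw [ContractSetting.principalUtility, h5]
      have h6 : 3 / 8 * s₂.real 15 0 ≤ (1 - (1 + a) / 2) * I.f S := by
        rw [hM]
        have := mul_le_mul_of_nonneg_left h4 (sub_nonneg.2 ha1.le)
        linarith
      have h7 : 3 / 8 * s₂.real 15 0 * I.reward ≤ (1 - (1 + a) / 2) * I.f S * I.reward := by
        gcongr
      have h8 : (8192 * s₂.real 15 0 + 6240 * I.f T) * I.reward ≤
        (8192 * s₂.real 15 0 + 6240 * s₂.real 15 0) * I.reward := by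
        gcongr
        linarith
      have h9 := mul_nonneg hF₂.1 hr.le
      linarith

/-- The cost bound is monotone in `n` and in `m`, so both may be replaced by `n + m`. -/
theorem exists_polynomial_contractCost :
    ∃ q : Polynomial ℕ, ∀ n m, contractCost n m ≤ q.eval (n + m) := by
  refine ⟨11 + .X * ((130 + 100 * .X + .X * (54 + .X + (3 * .X + 4) * (182 + 100 * .X))) + 14) +
    (16 + (2 * .X + 1) * ((71 + 41 * .X + .X * (28 + 2 * .X * (181 + 120 * .X))) + 19) +
      (22 + .X * 28)), fun n m => ?_⟩
  have hn : n ≤ n + m := Nat.le_add_right n m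
  have hm : m ≤ n + m := Nat.le_add_left m n
  simp only [Polynomial.eval_add, Polynomial.eval_mul, Polynomial.eval_X,
    Polynomial.eval_ofNat, Polynomial.eval_one]
  generalize n + m = t at *
  unfold contractCost searchAgentCost greedyRoundCost
  gcongr

end RealRAM

theorem theorem1 :
    ∃ κ : ℝ, 0 < κ ∧
    ∃ (P : RealRAM.Program) (q : Polynomial ℕ),
    ∀ (n m : ℕ) (I : ContractSetting n m), I.IsSubmodular →
    ∀ d : (Fin m → ℝ) → Finset (Fin m), IsDemandOracle I.f d →
    ∃ (s : RealRAM.State) (steps valueQueries demandQueries : ℕ),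
      RealRAM.Exec I.f d P (RealRAM.input I) (steps, valueQueries, demandQueries) s ∧
      steps ≤ q.eval (n + m) ∧
      valueQueries ≤ q.eval (n + m) ∧
      demandQueries ≤ q.eval (n + m) ∧
      ContractSetting.IsContract (RealRAM.output n s) ∧
      ∀ S : Finset (Fin m), I.IsNash (RealRAM.output n s) S →
        κ * I.optUtility ≤ I.principalUtility (RealRAM.output n s) S := by
  obtain ⟨q, hq⟩ := RealRAM.exists_polynomial_contractCost
  refine ⟨1 / 10 ^ 8, by norm_num, RealRAM.contractProgram, q, fun n m I hI d hd => ?_⟩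
  -- `Runs` bounds the sum of the three counts, hence each of them.
  obtain ⟨⟨t₁, t₂, t₃⟩, s, hE, ht, hQ⟩ := RealRAM.runs_contractProgram hI hd
  have hc := hq n m
  simp only at ht
  exact ⟨s, t₁, t₂, t₃, hE, by omega, by omega, by omega, hQ⟩
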